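/- Let $X\in\mathbb{R}^{n\times d}$ be deterministic with spectral norm $\|X\|=1$, let $w_*\in\mathbb{R}^d$, and let $Y=Xw_*+\varepsilon$, where $\varepsilon$ is a square-integrable centered random vector in $\mathbb{R}^n$ with covariance matrix $\Sigma_\varepsilon$. Let $D$ be a random real diagonal $n\times n$ matrix with finite fourth moments such that $M_2=\mathbb{E}[D^2]$ is non-singular, and let $D_1,D_2,\dots$ be independent copies of $D$; the sequence $(D_k)_{k\ge1}$ is independent of $\varepsilon$. Write $\Sigma_D$ for the covariance matrix of $(D_{11}^2,\dots,D_{nn}^2)$, $\widehat X=M_2^{1/2}X$, $\widehat{\mathbb{X}}=X^{\mathsf t}M_2X$, and let $A^+$ denote the Moore--Penrose pseudo-inverse, $\sigma^+_{\min}(A)$ the smallest non-zero singular value and $\|A\|$ the spectral norm of a matrix $A$. Let $\widehat w=\widehat X^+M_2^{1/2}Y$ be the weighted least squares estimator. For a constant step size $\alpha>0$ with $$\alpha\,\|\widehat{\mathbb{X}}\|<1\qquad\text{and}\qquad \alpha<\frac{\sigma^+_{\min}(\widehat{\mathbb{X}})}{\sigma^+_{\min}(\widehat{\mathbb{X}})^2+\|X\|^4\,\|\Sigma_D\|},$$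 and a deterministic initial guess $\widehat w_1\in\mathbb{R}^d$ orthogonal to $\ker(X)$, consider the randomly weighted gradient descent iterates $$\widehat w_{k+1}=\big(I-\alpha X^{\mathsf t}D_k^2X\big)\widehat w_k+\alpha X^{\mathsf t}D_k^2Y,\qquad k\ge1.$$ Then $\|w_*-\widehat w\|_2^2$ and, for every $k$, $\|w_*-\widehat w_k\|_2^2$ are integrable; the limit $\lim_{k\to\infty}\mathbb{E}\big[\|w_*-\widehat w_k\|_2^2\big]$ (expectation over both $\varepsilon$ and $(D_k)_{k\ge 1}$) exists and is finite; and $$C(X,w_*,M_2)\;\le\;\lim_{k\to\infty}\mathbb{E}\big[\|w_*-\widehat w_k\|_2^2\big]\;\le\;C(X,w_*,M_2)+\mathrm{Tr}\Big(\big(I-X\widehat X^+M_2^{1/2}\big)\Sigma_\varepsilon\big(I-X\widehat X^+M_2^{1/2}\big)^{\mathsf t}\Big),$$ where $$C(X,w_*,M_2)=\mathbb{E}\big[\|w_*-\widehat w\|_2^2\big]=\big\|(I-X^+X)w_*\big\|_2^2+\mathrm{Tr}\Big(\big(\widehat X^+M_2^{1/2}\big)\Sigma_\varepsilon\big(\widehat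 X^+M_2^{1/2}\big)^{\mathsf t}\Big).$$ -/

import Mathlib

open MeasureTheory ProbabilityTheory Filter Topology Matrix
open scoped Matrix.Norms.L2Operator

namespace WeightedGD

noncomputable section

/-! Vectors are functions `Fin d → ℝ`. The norm `‖A‖` of a matrix is the spectral norm, i.e. the
operator norm with respect to the Euclidean norms. -/

/-- The squared Euclidean norm `‖v‖₂²`. -/
def sqNorm {m : ℕ} (v : Fin m → ℝ) : ℝ := ‖WithLp.toLp 2 v‖ ^ 2

/-- The Moore–Penrose pseudo-inverse `A⁺ = (AᵀA)⁺ Aᵀ`. The pseudo-inverse of the symmetric matrix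
`AᵀA` inverts the non-zero eigenvalues and keeps the zero eigenvalues (`0⁻¹ = 0` in `ℝ`). If
`A = U Σ Vᵀ` is a singular value decomposition, this is `V Σ⁺ Uᵀ`. -/
def pinv {m d : ℕ} (A : Matrix (Fin m) (Fin d) ℝ) : Matrix (Fin d) (Fin m) ℝ :=
  cfc (fun x : ℝ => x⁻¹) (Aᵀ * A) * Aᵀ

theorem mul_eq_zero_of_gram_mul {m d : ℕ} (A : Matrix (Fin m) (Fin d) ℝ) (B : Matrix (Fin d) (Fin d) ℝ)
    (h : Aᵀ * A * B = 0) : A * B = 0 := by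
  have h1 : (A * B)ᵀ * (A * B) = 0 := by
    rw [Matrix.transpose_mul, Matrix.mul_assoc, ← Matrix.mul_assoc Aᵀ, h, Matrix.mul_zero]
  have := Matrix.conjTranspose_mul_self_eq_zero (A := A * B)
  rw [Matrix.conjTranspose_eq_transpose_of_trivial] at this
  exact this.1 h1

/-- `pinv A` satisfies the four Penrose equations. -/
theorem pinv_penrose {m d : ℕ} (A : Matrix (Fin m) (Fin d) ℝ) :
    A * pinv A * A = A ∧ pinv A * A * pinv A = pinv A ∧
      (A * pinv A)ᵀ = A * pinv A ∧ (pinv A * A)ᵀ = pinv A * A := by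
  have hsa : IsSelfAdjoint (Aᵀ * A) := by
    rw [← Matrix.conjTranspose_eq_transpose_of_trivial]
    exact (Matrix.isHermitian_conjTranspose_mul_self A).isSelfAdjoint
  have hfin : (spectrum ℝ (Aᵀ * A)).Finite := Matrix.finite_real_spectrum
  have hc : ∀ f : ℝ → ℝ, ContinuousOn f (spectrum ℝ (Aᵀ * A)) := fun f =>
    hfin.continuousOn f
  set G := cfc (fun x : ℝ => x⁻¹) (Aᵀ * A) with hG
  have hGsa : Gᵀ = G := by
    have h : IsSelfAdjoint G := cfc_predicate (fun x : ℝ => x⁻¹) (Aᵀ * A)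
    rw [← Matrix.conjTranspose_eq_transpose_of_trivial]; exact h
  have e1 : Aᵀ * A * G = G * (Aᵀ * A) := by
    have h := cfc_commute_cfc (fun x : ℝ => x) (fun x : ℝ => x⁻¹) (Aᵀ * A)
    rw [cfc_id' ℝ (Aᵀ * A)] at h
    exact h
  have e2 : Aᵀ * A * G * (Aᵀ * A) = Aᵀ * A := by
    have h : cfc (fun x : ℝ => x * x⁻¹ * x) (Aᵀ * A) = Aᵀ * A * G * (Aᵀ * A) := by
      rw [cfc_mul (fun x : ℝ => x * x⁻¹) (fun x => x) _ (hc _) (hc _),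
        cfc_mul (fun x : ℝ => x) (fun x => x⁻¹) _ (hc _) (hc _), cfc_id' ℝ (Aᵀ * A)]
    rw [← h]
    simp only [mul_inv_mul_cancel]
    exact cfc_id' ℝ (Aᵀ * A)
  have e3 : G * (Aᵀ * A) * G = G := by
    have h : cfc (fun x : ℝ => x⁻¹ * x * x⁻¹) (Aᵀ * A) = G * (Aᵀ * A) * G := by
      rw [cfc_mul (fun x : ℝ => x⁻¹ * x) (fun x => x⁻¹) _ (hc _) (hc _),
        cfc_mul (fun x : ℝ => x⁻¹) (fun x => x) _ (hc _) (hc _), cfc_id' ℝ (Aᵀ * A)]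
    rw [← h, hG]
    congr 1
    funext x
    by_cases hx : x = 0 <;> simp [hx]
  have hp : pinv A = G * Aᵀ := rfl
  refine ⟨?_, ?_, ?_, ?_⟩
  · have h : A * (G * (Aᵀ * A) - 1) = 0 := by
      apply mul_eq_zero_of_gram_mul
      rw [Matrix.mul_sub, ← Matrix.mul_assoc, e2, Matrix.mul_one, sub_self]
    rw [Matrix.mul_sub, Matrix.mul_one, sub_eq_zero] at h
    rw [hp]; simpa [Matrix.mul_assoc] using h
  · rw [hp]
    have h := congrArg (· * Aᵀ) e3
    simpa [Matrix.mul_assoc] using h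
  · rw [hp]; simp [Matrix.transpose_mul, hGsa, Matrix.mul_assoc]
  · rw [hp, Matrix.mul_assoc, Matrix.transpose_mul, hGsa, Matrix.transpose_mul,
      Matrix.transpose_transpose, e1]

/-- The smallest non-zero singular value. -/
def sigmaMinPos {m d : ℕ} (A : Matrix (Fin m) (Fin d) ℝ) : ℝ :=
  sInf {s : ℝ | 0 < s ∧ ∃ i : ℕ, (Matrix.toEuclideanLin A).singularValues i = s}

/-- The covariance matrix of a random vector. -/
def covMatrix {Ω : Type*} [MeasurableSpace Ω] (μ : Measure Ω) {m : ℕ} (Z : Ω → Fin m → ℝ) :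
    Matrix (Fin m) (Fin m) ℝ :=
  Matrix.of fun i j => cov[fun ω => Z ω i, fun ω => Z ω j; μ]

/-! A random diagonal matrix `D` is given by the random vector of its diagonal entries. -/

/-- `M₂ = 𝔼[D²]`. -/
def M2 {Ω : Type*} [MeasurableSpace Ω] (μ : Measure Ω) {n : ℕ} (D : Ω → Fin n → ℝ) :
    Matrix (Fin n) (Fin n) ℝ :=
  Matrix.diagonal fun i => ∫ ω, D ω i ^ 2 ∂μ

/-- `M₂^{1/2}`, the positive semi-definite square root of the diagonal matrix `M₂`. -/
def sqrtM2 {Ω : Type*} [MeasurableSpace Ω] (μ : Measure Ω) {n : ℕ} (D : Ω → Fin n → ℝ) :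
    Matrix (Fin n) (Fin n) ℝ :=
  Matrix.diagonal fun i => √(∫ ω, D ω i ^ 2 ∂μ)

theorem sqrtM2_mul_self {Ω : Type*} [MeasurableSpace Ω] (μ : Measure Ω) {n : ℕ}
    (D : Ω → Fin n → ℝ) : sqrtM2 μ D * sqrtM2 μ D = M2 μ D := by
  simp only [sqrtM2, M2, Matrix.diagonal_mul_diagonal]
  congr 1; funext i
  exact Real.mul_self_sqrt (integral_nonneg fun ω => sq_nonneg _)

theorem sqrtM2_posSemidef {Ω : Type*} [MeasurableSpace Ω] (μ : Measure Ω) {n : ℕ}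
    (D : Ω → Fin n → ℝ) : (sqrtM2 μ D).PosSemidef :=
  Matrix.PosSemidef.diagonal fun _ => Real.sqrt_nonneg _

/-- `Σ_D`, the covariance matrix of the random vector `(D₁₁², …, Dₙₙ²)`. -/
def SigmaD {Ω : Type*} [MeasurableSpace Ω] (μ : Measure Ω) {n : ℕ} (D : Ω → Fin n → ℝ) :
    Matrix (Fin n) (Fin n) ℝ :=
  covMatrix μ fun ω i => D ω i ^ 2

/-- `X̂ = M₂^{1/2} X`. -/
def Xhat {Ω : Type*} [MeasurableSpace Ω] (μ : Measure Ω) {n d : ℕ} (D : Ω → Fin n → ℝ)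
    (X : Matrix (Fin n) (Fin d) ℝ) : Matrix (Fin n) (Fin d) ℝ :=
  sqrtM2 μ D * X

/-- `𝕏̂ = Xᵀ M₂ X`. -/
def XXhat {Ω : Type*} [MeasurableSpace Ω] (μ : Measure Ω) {n d : ℕ} (D : Ω → Fin n → ℝ)
    (X : Matrix (Fin n) (Fin d) ℝ) : Matrix (Fin d) (Fin d) ℝ :=
  Xᵀ * M2 μ D * X

/-- The weighted least squares estimator `ŵ = X̂⁺ Ŷ` with `Ŷ = M₂^{1/2} Y`. -/
def wHat {Ω : Type*} [MeasurableSpace Ω] (μ : Measure Ω) {n d : ℕ} (D : Ω → Fin n → ℝ)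
    (X : Matrix (Fin n) (Fin d) ℝ) (y : Fin n → ℝ) : Fin d → ℝ :=
  pinv (Xhat μ D X) *ᵥ (sqrtM2 μ D *ᵥ y)

/-- The randomly weighted gradient descent iterates
`ŵ_{k+1} = (I - α_k Xᵀ D_k² X) ŵ_k + α_k Xᵀ D_k² Y`, here for fixed outcomes `D k` of the
(diagonals of the) weighting matrices and fixed labels `y`. The counter starts at `0`: the value at
`k` is the initial guess `w₁` after `k` steps. -/
def iterate {n d : ℕ} (X : Matrix (Fin n) (Fin d) ℝ) (α : ℕ → ℝ) (w₁ : Fin d → ℝ)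
    (D : ℕ → Fin n → ℝ) (y : Fin n → ℝ) : ℕ → Fin d → ℝ
  | 0 => w₁
  | k + 1 =>
      (1 - α k • (Xᵀ * Matrix.diagonal (D k) ^ 2 * X)) *ᵥ iterate X α w₁ D y k
        + α k • (Xᵀ *ᵥ (Matrix.diagonal (D k) ^ 2 *ᵥ y))

end

end WeightedGD

namespace WeightedGD

/-! Measure the iterates from the weighted least squares estimator `ŵ`. Put `P = 1 - α • 𝕏̂`, let `c
k` be the diagonal of `D_k² - M₂`, and let `r = Y - X ŵ`, a linear function `K ε` of the noise
alone. The normal equations `Xᵀ M₂ r = 0` remove the mean drift of the residual, so the deviation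
obeys `e ↦ P e - α Xᵀ (c k * (X e - r))` (`iterate_sub_eq_errRec`), driven by centered weights that
are independent of the past and of `ε`.

This recursion is linear in its starting point and its residual jointly (`errRec_add`), so the
deviation is `a k + b k`: `a` carries the initial error and no residual, `b` starts at zero and
carries `r`. Both stay orthogonal to `ker X`, where `P` contracts squared norms by `(1 - ασ)²`; the
random weights add at most `α² ‖Σ_D‖` times the mean square of `X e - r`. Under the step size
condition `𝔼‖a k‖²` decays geometrically (`tendsto_integral_sqNorm_errRec_zero`), while `𝔼‖b k‖² ≤
𝔼‖r‖²` (`integral_sqNorm_errRec_le`). The second moment matrix of `b k` follows an affine recursion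
whose linear part preserves positive semi-definiteness, so `𝔼‖b k‖²` also increases
(`monotone_integral_sqNorm_errRec`) and has a limit between `0` and `𝔼‖r‖²`.

Finally, `b k` is uncorrelated with every square-integrable function of the noise
(`mom_errRec_eq_zero`), in particular with `w_* - ŵ`. Pythagoras and the vanishing of `a` show that
the limiting risk is exactly `C + lim 𝔼‖b k‖²`, which gives both bounds. -/

/-! ### Euclidean norms, singular values and the deterministic contraction -/

theorem sqNorm_eq_dotProduct {m : ℕ} (v : Fin m → ℝ) : sqNorm v = v ⬝ᵥ v := by
  rw [sqNorm, EuclideanSpace.norm_sq_eq, dotProduct]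
  exact Finset.sum_congr rfl fun i _ => by simp [sq]

theorem sqNorm_eq_sum {m : ℕ} (v : Fin m → ℝ) : sqNorm v = ∑ i, v i ^ 2 := by
  rw [sqNorm_eq_dotProduct, dotProduct]
  exact Finset.sum_congr rfl fun i _ => (sq _).symm

theorem sqNorm_nonneg {m : ℕ} (v : Fin m → ℝ) : 0 ≤ sqNorm v := sq_nonneg _

theorem mulVec_dotProduct {m d : ℕ} (A : Matrix (Fin m) (Fin d) ℝ) (u : Fin d → ℝ)
    (w : Fin m → ℝ) : (A *ᵥ u) ⬝ᵥ w = u ⬝ᵥ (Aᵀ *ᵥ w) := by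
  rw [Matrix.dotProduct_mulVec, Matrix.vecMul_transpose]

theorem sqNorm_mulVec_le {m d : ℕ} (A : Matrix (Fin m) (Fin d) ℝ) (v : Fin d → ℝ) :
    sqNorm (A *ᵥ v) ≤ ‖A‖ ^ 2 * sqNorm v := by
  have h := Matrix.l2_opNorm_mulVec A (WithLp.toLp 2 v)
  simp only [sqNorm, ← mul_pow]
  exact pow_le_pow_left₀ (norm_nonneg _) h 2

theorem sqNorm_transpose_mulVec_le {m d : ℕ} (A : Matrix (Fin m) (Fin d) ℝ) (v : Fin m → ℝ) :
    sqNorm (Aᵀ *ᵥ v) ≤ ‖A‖ ^ 2 * sqNorm v := by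
  have h := sqNorm_mulVec_le Aᵀ v
  rwa [← Matrix.conjTranspose_eq_transpose_of_trivial, Matrix.l2_opNorm_conjTranspose,
    Matrix.conjTranspose_eq_transpose_of_trivial] at h

theorem diag_le_norm {m : ℕ} (A : Matrix (Fin m) (Fin m) ℝ) (i : Fin m) : A i i ≤ ‖A‖ := by
  have h := sqNorm_mulVec_le A (Pi.single i 1)
  have h1 : sqNorm (Pi.single i 1 : Fin m → ℝ) = 1 := by simp [sqNorm_eq_dotProduct]
  rw [h1, mul_one, sqNorm_eq_sum] at h
  have h2 : A i i ^ 2 ≤ ‖A‖ ^ 2 := by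
    refine le_trans ?_ h
    have := Finset.single_le_sum (f := fun j => (A *ᵥ Pi.single i 1) j ^ 2)
      (fun j _ => sq_nonneg _) (Finset.mem_univ i)
    simpa using this
  exact (abs_le_of_sq_le_sq' h2 (norm_nonneg _)).2

theorem sigmaMinPos_nonneg {m d : ℕ} (A : Matrix (Fin m) (Fin d) ℝ) : 0 ≤ sigmaMinPos A :=
  Real.sInf_nonneg fun _ hs => hs.1.le

/-- By symmetry `u` is an eigenvector of `HᵀH` for `l²`, so `l = √(l²)` is one of the singular
values over which the infimum runs. -/
theorem sigmaMinPos_le_of_eigenvalue {d : ℕ} {H : Matrix (Fin d) (Fin d) ℝ} (hH : H.IsHermitian)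
    {l : ℝ} (hl : 0 < l) {u : EuclideanSpace ℝ (Fin d)} (hu : u ≠ 0)
    (hHu : Matrix.toEuclideanLin H u = l • u) : sigmaMinPos H ≤ l := by
  refine csInf_le ⟨0, fun s hs => hs.1.le⟩ ⟨hl, ?_⟩
  set T := Matrix.toEuclideanLin H
  have hT : LinearMap.adjoint T = T := by
    rw [← Matrix.toEuclideanLin_conjTranspose_eq_adjoint, hH.eq]
  have hE : Module.End.HasEigenvalue (LinearMap.adjoint T ∘ₗ T) ((l ^ 2 : ℝ)) := by
    refine Module.End.hasEigenvalue_of_hasEigenvector (x := u) ⟨?_, hu⟩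
    rw [Module.End.mem_eigenspace_iff, LinearMap.comp_apply, hT, hHu, map_smul, hHu, smul_smul, sq]
  obtain ⟨i, hi⟩ := T.isSymmetric_adjoint_comp_self.exists_eigenvalues_eq rfl hE
  refine ⟨i, ?_⟩
  rw [T.singularValues_fin rfl i]
  have hi' : T.isSymmetric_adjoint_comp_self.eigenvalues rfl i = l ^ 2 := by simpa using hi
  rw [hi', Real.sqrt_sq hl.le]

/-- A gradient step with a positive semi-definite matrix contracts the orthogonal complement of the
kernel. -/
theorem sqNorm_one_sub_smul_mulVec_le {d : ℕ} {H : Matrix (Fin d) (Fin d) ℝ} (hH : H.PosSemidef)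
    {α : ℝ} (hα : 0 < α) (hα_norm : α * ‖H‖ < 1) {v : Fin d → ℝ}
    (hv : ∀ u : Fin d → ℝ, H *ᵥ u = 0 → v ⬝ᵥ u = 0) :
    sqNorm ((1 - α • H) *ᵥ v) ≤ (1 - α * sigmaMinPos H) ^ 2 * sqNorm v := by
  have hs := hH.isHermitian
  set b := hs.eigenvectorBasis
  have key : ∀ w : Fin d → ℝ, sqNorm w = ∑ i, ((b i).ofLp ⬝ᵥ w) ^ 2 := by
    intro w
    rw [sqNorm, ← b.sum_sq_norm_inner_right]
    refine Finset.sum_congr rfl fun i _ => ?_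
    rw [EuclideanSpace.inner_eq_star_dotProduct]
    simp [dotProduct_comm]
  rw [key, key v, Finset.mul_sum]
  refine Finset.sum_le_sum fun i _ => ?_
  have hHb : H *ᵥ (b i).ofLp = hs.eigenvalues i • (b i).ofLp := hs.mulVec_eigenvectorBasis i
  have hHt : Hᵀ = H := by
    rw [← Matrix.conjTranspose_eq_transpose_of_trivial]; exact hs
  have e : (b i).ofLp ⬝ᵥ ((1 - α • H) *ᵥ v)
      = (1 - α * hs.eigenvalues i) * ((b i).ofLp ⬝ᵥ v) := by
    rw [Matrix.sub_mulVec, Matrix.one_mulVec, Matrix.smul_mulVec, dotProduct_sub,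
      dotProduct_smul, Matrix.dotProduct_mulVec, ← Matrix.mulVec_transpose, hHt, hHb,
      smul_dotProduct, smul_eq_mul, smul_eq_mul]
    ring
  rw [e, mul_pow]
  have hlam : 0 ≤ hs.eigenvalues i := hH.eigenvalues_nonneg i
  rcases hlam.eq_or_lt with h0 | hpos
  -- For eigenvalue zero the eigenvector lies in the kernel, so `v` has no component along it.
  · rw [← h0, zero_smul] at hHb
    rw [dotProduct_comm, hv _ hHb]
    simp
  · have hne : b i ≠ 0 := b.orthonormal.ne_zero i
    have h1 : sigmaMinPos H ≤ hs.eigenvalues i := by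
      refine sigmaMinPos_le_of_eigenvalue hs hpos hne ?_
      apply WithLp.ofLp_injective
      simpa using hHb
    have h2 : hs.eigenvalues i ≤ ‖H‖ := by
      have h := sqNorm_mulVec_le H (b i).ofLp
      have h3 : sqNorm (b i).ofLp = 1 := by simp [sqNorm, b.orthonormal.1 i]
      rw [hHb, h3, mul_one, sqNorm_eq_dotProduct, smul_dotProduct, dotProduct_smul,
        ← sqNorm_eq_dotProduct, h3] at h
      refine (abs_le_of_sq_le_sq' ?_ (norm_nonneg _)).2
      simpa [sq] using h
    -- With `λ` the eigenvalue, `α‖H‖ < 1` gives `0 ≤ 1 - αλ ≤ 1 - ασ`; nonnegativity is what allows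
    -- squaring.
    have h4 := mul_le_mul_of_nonneg_left h1 hα.le
    have h5 := mul_le_mul_of_nonneg_left h2 hα.le
    gcongr
    linarith

/-! ### Pseudo-inverses -/

variable {n d : ℕ} (X : Matrix (Fin n) (Fin d) ℝ) {S : Matrix (Fin n) (Fin n) ℝ}

theorem mul_pinv_mul_weighted (hS : IsUnit S) : X * (pinv (S * X) * (S * X)) = X := by
  have h := (pinv_penrose (S * X)).1
  rw [Matrix.mul_assoc, Matrix.mul_assoc] at h
  have hd : IsUnit S.det := (Matrix.isUnit_iff_isUnit_det S).1 hS
  rw [← Matrix.nonsing_inv_mul_cancel_left S (X * _) hd, h, Matrix.nonsing_inv_mul_cancel_left S X hd]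

/-- Both sides are orthogonal projections with the same kernel `ker X`: each absorbs the other, and
transposing one absorption relation yields equality. Hence the bias of `ŵ` does not depend on the
weighting. -/
theorem pinv_mul_self_weighted (hS : IsUnit S) : pinv (S * X) * (S * X) = pinv X * X := by
  have h1 : pinv X * X * (pinv (S * X) * (S * X)) = pinv X * X := by
    rw [Matrix.mul_assoc, mul_pinv_mul_weighted X hS]
  have h2 : pinv (S * X) * (S * X) * (pinv X * X) = pinv (S * X) * (S * X) := by
    have := (pinv_penrose X).1
    rw [Matrix.mul_assoc] at this
    rw [Matrix.mul_assoc, Matrix.mul_assoc S, this]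
  have h3 := congrArg Matrix.transpose h2
  rwa [Matrix.transpose_mul, (pinv_penrose (S * X)).2.2.2, (pinv_penrose X).2.2.2, h1, eq_comm] at h3

/-- Values of the pseudo-inverse are orthogonal to the kernel. -/
theorem pinv_mulVec_dotProduct (y : Fin n → ℝ) {v : Fin d → ℝ} (hv : X *ᵥ v = 0) :
    (pinv X *ᵥ y) ⬝ᵥ v = 0 := by
  rw [← (pinv_penrose X).2.1, ← Matrix.mulVec_mulVec, dotProduct_comm, Matrix.dotProduct_mulVec,
    ← Matrix.mulVec_transpose, (pinv_penrose X).2.2.2, ← Matrix.mulVec_mulVec, hv,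
    Matrix.mulVec_zero, zero_dotProduct]

/-- The normal equations. -/
theorem transpose_mul_mul_residual (S : Matrix (Fin n) (Fin n) ℝ) (hSt : Sᵀ = S) :
    Xᵀ * (S * S) * (1 - X * pinv (S * X) * S) = 0 := by
  have h := congrArg Matrix.transpose (pinv_penrose (S * X)).1
  rw [Matrix.transpose_mul, (pinv_penrose (S * X)).2.2.1, Matrix.transpose_mul, hSt] at h
  have h2 := congrArg (· * S) h
  simp only [Matrix.mul_assoc] at h2
  simp only [Matrix.mul_sub, Matrix.mul_one, Matrix.mul_assoc]
  rw [h2, sub_self]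

theorem mulVec_eq_zero_of_transpose_mul_mul (hSt : Sᵀ = S) (hS : IsUnit S) {u : Fin d → ℝ}
    (hu : (Xᵀ * (S * S) * X) *ᵥ u = 0) : X *ᵥ u = 0 := by
  have h1 : sqNorm (S *ᵥ (X *ᵥ u)) = 0 := by
    rw [sqNorm_eq_dotProduct, mulVec_dotProduct, mulVec_dotProduct, hSt]
    have : Xᵀ *ᵥ (S *ᵥ (S *ᵥ (X *ᵥ u))) = 0 := by
      simpa [Matrix.mulVec_mulVec, Matrix.mul_assoc] using hu
    rw [this, dotProduct_zero]
  have h2 : S *ᵥ (X *ᵥ u) = 0 := by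
    rw [sqNorm_eq_dotProduct] at h1
    exact dotProduct_self_eq_zero.1 h1
  exact Matrix.mulVec_injective_of_isUnit hS (by rw [h2, Matrix.mulVec_zero])

/-! ### Calculus of mixed second moments -/

/-- The matrix `𝔼[U Wᵀ]` of mixed second moments. -/
noncomputable def mom {Ω : Type*} [MeasurableSpace Ω] (μ : Measure Ω) {m d : ℕ}
    (U : Ω → Fin m → ℝ) (W : Ω → Fin d → ℝ) : Matrix (Fin m) (Fin d) ℝ :=
  Matrix.of fun i j => ∫ ω, U ω i * W ω j ∂μ

/-- Square-integrability of all coordinates. -/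
def SqIntegrable {Ω : Type*} [MeasurableSpace Ω] (μ : Measure Ω) {m : ℕ}
    (U : Ω → Fin m → ℝ) : Prop :=
  ∀ i, MemLp (fun ω => U ω i) 2 μ

section Moments

variable {Ω : Type*} [MeasurableSpace Ω] {μ : Measure Ω} {m d p : ℕ}

theorem SqIntegrable.mulVec {U : Ω → Fin d → ℝ} (hU : SqIntegrable μ U)
    (A : Matrix (Fin m) (Fin d) ℝ) : SqIntegrable μ fun ω => A *ᵥ U ω := fun i =>
  memLp_finsetSum (f := fun j ω => A i j * U ω j) Finset.univ fun j _ => (hU j).const_mul (A i j)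

theorem SqIntegrable.sub {U V : Ω → Fin d → ℝ} (hU : SqIntegrable μ U) (hV : SqIntegrable μ V) :
    SqIntegrable μ fun ω => U ω - V ω := fun i => (hU i).sub (hV i)

theorem SqIntegrable.add {U V : Ω → Fin d → ℝ} (hU : SqIntegrable μ U) (hV : SqIntegrable μ V) :
    SqIntegrable μ fun ω => U ω + V ω := fun i => (hU i).add (hV i)

theorem SqIntegrable.smul {U : Ω → Fin d → ℝ} (hU : SqIntegrable μ U) (a : ℝ) :
    SqIntegrable μ fun ω => a • U ω := fun i => (hU i).const_mul a

theorem SqIntegrable.const [IsFiniteMeasure μ] (v : Fin d → ℝ) :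
    SqIntegrable μ fun _ : Ω => v := fun i => memLp_const (v i)

theorem SqIntegrable.aemeasurable {U : Ω → Fin d → ℝ} (hU : SqIntegrable μ U) :
    AEMeasurable U μ :=
  aemeasurable_pi_lambda _ fun i => (hU i).aestronglyMeasurable.aemeasurable

theorem SqIntegrable.integrable_mul {U : Ω → Fin m → ℝ} {W : Ω → Fin d → ℝ}
    (hU : SqIntegrable μ U) (hW : SqIntegrable μ W) (i : Fin m) (j : Fin d) :
    Integrable (fun ω => U ω i * W ω j) μ := (hU i).integrable_mul (hW j)

theorem SqIntegrable.integrable_dotProduct {U W : Ω → Fin m → ℝ}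
    (hU : SqIntegrable μ U) (hW : SqIntegrable μ W) :
    Integrable (fun ω => U ω ⬝ᵥ W ω) μ :=
  integrable_finsetSum _ fun i _ => hU.integrable_mul hW i i

theorem SqIntegrable.integrable_sqNorm {U : Ω → Fin m → ℝ} (hU : SqIntegrable μ U) :
    Integrable (fun ω => sqNorm (U ω)) μ := by
  simp only [sqNorm_eq_dotProduct]
  exact hU.integrable_dotProduct hU

theorem integral_dotProduct {U W : Ω → Fin m → ℝ} (hU : SqIntegrable μ U)
    (hW : SqIntegrable μ W) : ∫ ω, U ω ⬝ᵥ W ω ∂μ = (mom μ U W).trace := by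
  simp only [dotProduct, Matrix.trace, mom, Matrix.diag_apply, Matrix.of_apply]
  exact integral_finsetSum _ fun i _ => hU.integrable_mul hW i i

theorem integral_sqNorm {U : Ω → Fin m → ℝ} (hU : SqIntegrable μ U) :
    ∫ ω, sqNorm (U ω) ∂μ = (mom μ U U).trace := by
  simp only [sqNorm_eq_dotProduct]
  exact integral_dotProduct hU hU

theorem mom_transpose (U : Ω → Fin m → ℝ) (W : Ω → Fin d → ℝ) : (mom μ U W)ᵀ = mom μ W U := by
  ext i j
  simp [mom, mul_comm]

theorem mom_mulVec_left {U : Ω → Fin m → ℝ} {W : Ω → Fin d → ℝ} (hU : SqIntegrable μ U)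
    (hW : SqIntegrable μ W) (A : Matrix (Fin p) (Fin m) ℝ) :
    mom μ (fun ω => A *ᵥ U ω) W = A * mom μ U W := by
  ext i j
  simp only [mom, Matrix.of_apply, Matrix.mul_apply, Matrix.mulVec, dotProduct, Finset.sum_mul,
    mul_assoc]
  rw [integral_finsetSum _ fun a _ => (hU.integrable_mul hW a j).const_mul _]
  simp only [integral_const_mul]

theorem mom_mulVec_right {U : Ω → Fin m → ℝ} {W : Ω → Fin d → ℝ} (hU : SqIntegrable μ U)
    (hW : SqIntegrable μ W) (A : Matrix (Fin p) (Fin d) ℝ) :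
    mom μ U (fun ω => A *ᵥ W ω) = mom μ U W * Aᵀ := by
  rw [← mom_transpose, mom_mulVec_left hW hU, Matrix.transpose_mul, mom_transpose]

theorem mom_sub_left {U V : Ω → Fin m → ℝ} {W : Ω → Fin d → ℝ} (hU : SqIntegrable μ U)
    (hV : SqIntegrable μ V) (hW : SqIntegrable μ W) :
    mom μ (fun ω => U ω - V ω) W = mom μ U W - mom μ V W := by
  ext i j
  simp only [mom, Matrix.of_apply, Matrix.sub_apply, Pi.sub_apply, sub_mul]
  exact integral_sub (hU.integrable_mul hW i j) (hV.integrable_mul hW i j)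

theorem mom_sub_right {U : Ω → Fin m → ℝ} {V W : Ω → Fin d → ℝ} (hU : SqIntegrable μ U)
    (hV : SqIntegrable μ V) (hW : SqIntegrable μ W) :
    mom μ U (fun ω => V ω - W ω) = mom μ U V - mom μ U W := by
  rw [← mom_transpose, mom_sub_left hV hW hU, Matrix.transpose_sub, mom_transpose, mom_transpose]

theorem mom_sub_self {U V : Ω → Fin m → ℝ} (hU : SqIntegrable μ U) (hV : SqIntegrable μ V)
    (h : mom μ U V = 0) :
    mom μ (fun ω => U ω - V ω) (fun ω => U ω - V ω) = mom μ U U + mom μ V V := by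
  have h' : mom μ V U = 0 := by rw [← mom_transpose, h, Matrix.transpose_zero]
  rw [mom_sub_left hU hV (hU.sub hV), mom_sub_right hU hU hV, mom_sub_right hV hU hV, h, h']
  abel

theorem mom_smul_left (U : Ω → Fin m → ℝ) (W : Ω → Fin d → ℝ) (a : ℝ) :
    mom μ (fun ω => a • U ω) W = a • mom μ U W := by
  ext i j
  simp [mom, mul_assoc, integral_const_mul]

theorem mom_smul_right (U : Ω → Fin m → ℝ) (W : Ω → Fin d → ℝ) (a : ℝ) :
    mom μ U (fun ω => a • W ω) = a • mom μ U W := by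
  rw [← mom_transpose, mom_smul_left, Matrix.transpose_smul, mom_transpose]

theorem mom_self_posSemidef {U : Ω → Fin m → ℝ} (hU : SqIntegrable μ U) :
    (mom μ U U).PosSemidef := by
  refine Matrix.PosSemidef.of_dotProduct_mulVec_nonneg ?_ fun x => ?_
  · rw [Matrix.IsHermitian, Matrix.conjTranspose_eq_transpose_of_trivial, mom_transpose]
  -- Reading `x` as a one-row matrix turns the quadratic form into `𝔼[(x ⬝ᵥ U)²]`.
  · have h : star x ⬝ᵥ (mom μ U U *ᵥ x)
        = (mom μ (fun ω => (Matrix.of fun (_ : Fin 1) j => x j) *ᵥ U ω)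
          (fun ω => (Matrix.of fun (_ : Fin 1) j => x j) *ᵥ U ω)) 0 0 := by
      rw [mom_mulVec_left hU (hU.mulVec _), mom_mulVec_right hU hU]
      simp [Matrix.mul_apply, dotProduct, Matrix.mulVec]
    rw [h]
    exact integral_nonneg fun ω => mul_self_nonneg _

/-- Cauchy–Schwarz for random vectors. -/
theorem sq_integral_dotProduct_le {U W : Ω → Fin m → ℝ} (hU : SqIntegrable μ U)
    (hW : SqIntegrable μ W) :
    (∫ ω, U ω ⬝ᵥ W ω ∂μ) ^ 2 ≤ (∫ ω, sqNorm (U ω) ∂μ) * ∫ ω, sqNorm (W ω) ∂μ := by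
  -- The quadratic `t ↦ 𝔼‖tU + W‖²` is nonnegative, so its discriminant is not positive.
  have h : ∀ t : ℝ, 0 ≤ (∫ ω, sqNorm (U ω) ∂μ) * (t * t) + (2 * ∫ ω, U ω ⬝ᵥ W ω ∂μ) * t
      + ∫ ω, sqNorm (W ω) ∂μ := by
    intro t
    have e : (∫ ω, sqNorm (U ω) ∂μ) * (t * t) + (2 * ∫ ω, U ω ⬝ᵥ W ω ∂μ) * t
        + ∫ ω, sqNorm (W ω) ∂μ = ∫ ω, sqNorm (t • U ω + W ω) ∂μ := by
      have e1 : ∀ ω, sqNorm (t • U ω + W ω)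
          = t * t * sqNorm (U ω) + 2 * t * (U ω ⬝ᵥ W ω) + sqNorm (W ω) := by
        intro ω
        simp only [sqNorm_eq_dotProduct, add_dotProduct, dotProduct_add, smul_dotProduct,
          dotProduct_smul, smul_eq_mul, dotProduct_comm (W ω) (U ω)]
        ring
      have i1 := hU.integrable_sqNorm.const_mul (t * t)
      have i2 := (hU.integrable_dotProduct hW).const_mul (2 * t)
      have i3 : Integrable (fun ω => t * t * sqNorm (U ω) + 2 * t * (U ω ⬝ᵥ W ω)) μ := i1.add i2
      simp only [e1]
      rw [integral_add i3 hW.integrable_sqNorm, integral_add i1 i2, integral_const_mul,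
        integral_const_mul]
      ring
    rw [e]
    exact integral_nonneg fun ω => sqNorm_nonneg _
  have := discrim_le_zero h
  rw [discrim] at this
  linarith

end Moments

/-! ### Coordinatewise products with an independent weighting -/

section Independent

variable {Ω : Type*} [MeasurableSpace Ω] {μ : Measure Ω} {m d : ℕ}
  {c R : Ω → Fin m → ℝ}

/-- Independence passes to the squares, whose product is then integrable; no fourth moments of `R`
are needed. -/
theorem SqIntegrable.mul_of_indepFun (hc : SqIntegrable μ c) (hR : SqIntegrable μ R)
    (h : IndepFun c R μ) : SqIntegrable μ fun ω => c ω * R ω := by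
  intro i
  have hi : IndepFun (fun ω => c ω i ^ 2) (fun ω => R ω i ^ 2) μ :=
    h.comp (φ := fun x : Fin m → ℝ => x i ^ 2) (ψ := fun x : Fin m → ℝ => x i ^ 2)
      (by fun_prop) (by fun_prop)
  have hi' := hi.integrable_mul (hc i).integrable_sq (hR i).integrable_sq
  refine (memLp_two_iff_integrable_sq ((hc i).aestronglyMeasurable.mul (hR i).aestronglyMeasurable)).2 ?_
  refine hi'.congr (ae_of_all _ fun ω => ?_)
  simp [mul_pow]

theorem mom_mul_self_of_indepFun (hc : SqIntegrable μ c) (hR : SqIntegrable μ R)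
    (h : IndepFun c R μ) :
    mom μ (fun ω => c ω * R ω) (fun ω => c ω * R ω) = mom μ c c ⊙ mom μ R R := by
  ext i j
  have hi : IndepFun (fun ω => c ω i * c ω j) (fun ω => R ω i * R ω j) μ :=
    h.comp (φ := fun x : Fin m → ℝ => x i * x j) (ψ := fun x : Fin m → ℝ => x i * x j)
      (by fun_prop) (by fun_prop)
  have := hi.integral_fun_mul_eq_mul_integral (hc.integrable_mul hc i j).aestronglyMeasurable
    (hR.integrable_mul hR i j).aestronglyMeasurable
  simp only [mom, Matrix.of_apply, Matrix.hadamard_apply, Pi.mul_apply]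
  rw [← this]
  congr 1
  funext ω
  ring

theorem mom_mul_eq_zero_of_indepFun {W : Ω → Fin d → ℝ} (hc : SqIntegrable μ c)
    (hc0 : ∀ i, ∫ ω, c ω i ∂μ = 0) (hR : SqIntegrable μ R) (hW : SqIntegrable μ W)
    (h : IndepFun c (fun ω => (R ω, W ω)) μ) : mom μ (fun ω => c ω * R ω) W = 0 := by
  ext i j
  have hi : IndepFun (fun ω => c ω i) (fun ω => R ω i * W ω j) μ :=
    h.comp (φ := fun x : Fin m → ℝ => x i)
      (ψ := fun x : (Fin m → ℝ) × (Fin d → ℝ) => x.1 i * x.2 j) (by fun_prop) (by fun_prop)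
  have := hi.integral_fun_mul_eq_mul_integral (hc i).aestronglyMeasurable
    (hR.integrable_mul hW i j).aestronglyMeasurable
  simp only [mom, Matrix.of_apply, Matrix.zero_apply, Pi.mul_apply, mul_assoc]
  rw [this, hc0, zero_mul]

end Independent

/-! ### One step of the error recursion -/

/-- One step of the recursion for the estimation error: `P` is the mean of the random matrix,
`c` is the centered weighting, and `r` is the residual. -/
def errStep {n d : ℕ} (X : Matrix (Fin n) (Fin d) ℝ) (α : ℝ) (P : Matrix (Fin d) (Fin d) ℝ)
    (r c : Fin n → ℝ) (u : Fin d → ℝ) : Fin d → ℝ :=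
  P *ᵥ u - α • (Xᵀ *ᵥ (c * (X *ᵥ u - r)))

section Step

variable {Ω : Type*} [MeasurableSpace Ω] {μ : Measure Ω} {n d m : ℕ}
  {X : Matrix (Fin n) (Fin d) ℝ} {α : ℝ} {P : Matrix (Fin d) (Fin d) ℝ}
  {c r : Ω → Fin n → ℝ} {U : Ω → Fin d → ℝ} {η : Ω → Fin m → ℝ}

theorem indepFun_residual (h : IndepFun c (fun ω => (U ω, r ω)) μ) :
    IndepFun c (fun ω => X *ᵥ U ω - r ω) μ :=
  h.comp (φ := id) (ψ := fun x : (Fin d → ℝ) × (Fin n → ℝ) => X *ᵥ x.1 - x.2) measurable_id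
    (by fun_prop)

theorem SqIntegrable.errStep (hc : SqIntegrable μ c) (hU : SqIntegrable μ U)
    (hr : SqIntegrable μ r) (h : IndepFun c (fun ω => (U ω, r ω)) μ) :
    SqIntegrable μ fun ω => errStep X α P (r ω) (c ω) (U ω) :=
  (hU.mulVec P).sub
    (((hc.mul_of_indepFun ((hU.mulVec X).sub hr) (indepFun_residual h)).mulVec Xᵀ).smul α)

theorem mom_errStep_of_mom_eq_zero (hc : SqIntegrable μ c) (hc0 : ∀ i, ∫ ω, c ω i ∂μ = 0)
    (hU : SqIntegrable μ U) (hr : SqIntegrable μ r) (hη : SqIntegrable μ η)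
    (h : IndepFun c (fun ω => (U ω, r ω)) μ) (h' : IndepFun c (fun ω => ((U ω, r ω), η ω)) μ)
    (hUη : mom μ U η = 0) :
    mom μ (fun ω => errStep X α P (r ω) (c ω) (U ω)) η = 0 := by
  have hR := (hU.mulVec X).sub hr
  have hcR := hc.mul_of_indepFun hR (indepFun_residual h)
  have h2 : IndepFun c (fun ω => (X *ᵥ U ω - r ω, η ω)) μ :=
    h'.comp (φ := id)
      (ψ := fun x : ((Fin d → ℝ) × (Fin n → ℝ)) × (Fin m → ℝ) => (X *ᵥ x.1.1 - x.1.2, x.2))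
      measurable_id (by fun_prop)
  simp only [WeightedGD.errStep]
  rw [mom_sub_left (hU.mulVec P) ((hcR.mulVec Xᵀ).smul α) hη, mom_mulVec_left hU hη, hUη,
    mom_smul_left, mom_mulVec_left hcR hη, mom_mul_eq_zero_of_indepFun hc hc0 hR hη h2]
  simp

/-- The cross terms between the mean step and the random step vanish because `c` is centered and
independent of `(U, r)`; independence also factorizes the moments of the random step into a Hadamard
product. -/
theorem mom_errStep (hc : SqIntegrable μ c) (hc0 : ∀ i, ∫ ω, c ω i ∂μ = 0)
    (hU : SqIntegrable μ U) (hr : SqIntegrable μ r) (h : IndepFun c (fun ω => (U ω, r ω)) μ) :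
    mom μ (fun ω => errStep X α P (r ω) (c ω) (U ω)) (fun ω => errStep X α P (r ω) (c ω) (U ω))
      = P * mom μ U U * Pᵀ + α ^ 2 • (Xᵀ * (mom μ c c ⊙
        mom μ (fun ω => X *ᵥ U ω - r ω) (fun ω => X *ᵥ U ω - r ω)) * X) := by
  have hR := (hU.mulVec X).sub hr
  have hcR := hc.mul_of_indepFun hR (indepFun_residual h)
  have h2 : IndepFun c (fun ω => (X *ᵥ U ω - r ω, P *ᵥ U ω)) μ :=
    h.comp (φ := id)
      (ψ := fun x : (Fin d → ℝ) × (Fin n → ℝ) => (X *ᵥ x.1 - x.2, P *ᵥ x.1))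
      measurable_id (by fun_prop)
  have h3 := mom_mul_eq_zero_of_indepFun hc hc0 hR (hU.mulVec P) h2
  have h4 : mom μ (fun ω => P *ᵥ U ω) (fun ω => α • (Xᵀ *ᵥ (c ω * (X *ᵥ U ω - r ω)))) = 0 := by
    rw [mom_smul_right, mom_mulVec_right (hU.mulVec P) hcR, ← mom_transpose, h3]
    simp
  simp only [WeightedGD.errStep]
  rw [mom_sub_self (hU.mulVec P) ((hcR.mulVec Xᵀ).smul α) h4, mom_smul_left, mom_smul_right,
    mom_mulVec_left hcR (hcR.mulVec _), mom_mulVec_right hcR hcR,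
    mom_mulVec_left hU (hU.mulVec P), mom_mulVec_right hU hU,
    mom_mul_self_of_indepFun hc hR (indepFun_residual h), smul_smul, ← sq,
    Matrix.transpose_transpose, Matrix.mul_assoc, Matrix.mul_assoc]

/-- The trace is `𝔼‖Xᵀ(c * R)‖²`. Since `Xᵀ` does not increase norms, only the diagonal of the
Hadamard product matters, that is, the second moments of the individual weights. -/
theorem trace_transpose_mul_hadamard_mul_le {s : ℝ} (hX : ‖X‖ ≤ 1)
    (hcs : ∀ i, mom μ c c i i ≤ s) {R : Ω → Fin n → ℝ} (hR : SqIntegrable μ R)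
    (hc : SqIntegrable μ c) (h : IndepFun c R μ) :
    (Xᵀ * (mom μ c c ⊙ mom μ R R) * X).trace ≤ s * ∫ ω, sqNorm (R ω) ∂μ := by
  have hcR := hc.mul_of_indepFun hR h
  have e : Xᵀ * (mom μ c c ⊙ mom μ R R) * X
      = mom μ (fun ω => Xᵀ *ᵥ (c ω * R ω)) (fun ω => Xᵀ *ᵥ (c ω * R ω)) := by
    rw [mom_mulVec_left hcR (hcR.mulVec _), mom_mulVec_right hcR hcR,
      mom_mul_self_of_indepFun hc hR h, Matrix.transpose_transpose, Matrix.mul_assoc]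
  rw [e, ← integral_sqNorm (hcR.mulVec Xᵀ)]
  calc ∫ ω, sqNorm (Xᵀ *ᵥ (c ω * R ω)) ∂μ ≤ ∫ ω, sqNorm (c ω * R ω) ∂μ := by
        refine integral_mono (hcR.mulVec Xᵀ).integrable_sqNorm hcR.integrable_sqNorm fun ω => ?_
        refine (sqNorm_transpose_mulVec_le X _).trans ?_
        exact mul_le_of_le_one_left (sqNorm_nonneg _) (pow_le_one₀ (norm_nonneg _) hX)
    _ = ∑ i, mom μ c c i i * mom μ R R i i := by
        rw [integral_sqNorm hcR, mom_mul_self_of_indepFun hc hR h]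
        rfl
    _ ≤ ∑ i, s * mom μ R R i i :=
        Finset.sum_le_sum fun i _ => mul_le_mul_of_nonneg_right (hcs i)
          (integral_nonneg fun ω => mul_self_nonneg _)
    _ = s * ∫ ω, sqNorm (R ω) ∂μ := by
        rw [integral_sqNorm hR, ← Finset.mul_sum]
        rfl

theorem integral_sqNorm_errStep_le {s ρ : ℝ} (hX : ‖X‖ ≤ 1) (hc : SqIntegrable μ c)
    (hc0 : ∀ i, ∫ ω, c ω i ∂μ = 0) (hcs : ∀ i, mom μ c c i i ≤ s)
    (hU : SqIntegrable μ U) (hr : SqIntegrable μ r) (h : IndepFun c (fun ω => (U ω, r ω)) μ)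
    (hP : ∀ ω, sqNorm (P *ᵥ U ω) ≤ ρ * sqNorm (U ω)) :
    ∫ ω, sqNorm (errStep X α P (r ω) (c ω) (U ω)) ∂μ
      ≤ ρ * (∫ ω, sqNorm (U ω) ∂μ)
        + α ^ 2 * (s * ∫ ω, sqNorm (X *ᵥ U ω - r ω) ∂μ) := by
  have hR := (hU.mulVec X).sub hr
  rw [integral_sqNorm (hc.errStep hU hr h), mom_errStep hc hc0 hU hr h, Matrix.trace_add,
    Matrix.trace_smul, smul_eq_mul]
  refine add_le_add ?_ (mul_le_mul_of_nonneg_left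
    (trace_transpose_mul_hadamard_mul_le hX hcs hR hc (indepFun_residual h)) (sq_nonneg α))
  rw [Matrix.mul_assoc, ← mom_mulVec_right hU hU, ← mom_mulVec_left hU (hU.mulVec P),
    ← integral_sqNorm (hU.mulVec P), ← integral_const_mul]
  exact integral_mono (hU.mulVec P).integrable_sqNorm (hU.integrable_sqNorm.const_mul ρ) hP

theorem mom_residual (hU : SqIntegrable μ U) (hr : SqIntegrable μ r) (h : mom μ U r = 0) :
    mom μ (fun ω => X *ᵥ U ω - r ω) (fun ω => X *ᵥ U ω - r ω)
      = X * mom μ U U * Xᵀ + mom μ r r := by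
  rw [mom_sub_self (hU.mulVec X) hr (by rw [mom_mulVec_left hU hr, h, Matrix.mul_zero]),
    mom_mulVec_left hU (hU.mulVec X), mom_mulVec_right hU hU, Matrix.mul_assoc]

theorem integral_sqNorm_residual_le (hX : ‖X‖ ≤ 1) (hU : SqIntegrable μ U)
    (hr : SqIntegrable μ r) (h : mom μ U r = 0) :
    ∫ ω, sqNorm (X *ᵥ U ω - r ω) ∂μ ≤ ∫ ω, sqNorm (U ω) ∂μ + ∫ ω, sqNorm (r ω) ∂μ := by
  rw [integral_sqNorm ((hU.mulVec X).sub hr), mom_residual hU hr h, Matrix.trace_add,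
    ← integral_sqNorm hr, Matrix.mul_assoc, ← mom_mulVec_right hU hU,
    ← mom_mulVec_left hU (hU.mulVec X), ← integral_sqNorm (hU.mulVec X)]
  refine add_le_add ?_ le_rfl
  refine integral_mono (hU.mulVec X).integrable_sqNorm hU.integrable_sqNorm fun ω => ?_
  exact (sqNorm_mulVec_le X _).trans
    (mul_le_of_le_one_left (sqNorm_nonneg _) (pow_le_one₀ (norm_nonneg _) hX))

end Step

/-! ### The error recursion, pathwise -/

/-- The error recursion driven by the sequence `c` of centered weightings. -/
def errRec {n d : ℕ} (X : Matrix (Fin n) (Fin d) ℝ) (α : ℝ) (P : Matrix (Fin d) (Fin d) ℝ)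
    (u₀ : Fin d → ℝ) (r : Fin n → ℝ) (c : ℕ → Fin n → ℝ) : ℕ → Fin d → ℝ
  | 0 => u₀
  | k + 1 => errStep X α P r (c k) (errRec X α P u₀ r c k)

section Deterministic

variable {n d : ℕ} {X : Matrix (Fin n) (Fin d) ℝ} {α : ℝ} {P : Matrix (Fin d) (Fin d) ℝ}

theorem errRec_congr {u₀ : Fin d → ℝ} {r : Fin n → ℝ} {c c' : ℕ → Fin n → ℝ} {k : ℕ}
    (h : ∀ j < k, c j = c' j) : errRec X α P u₀ r c k = errRec X α P u₀ r c' k := by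
  induction k with
  | zero => rfl
  | succ k ih =>
    simp only [errRec]
    rw [ih fun j hj => h j (hj.trans k.lt_succ_self), h k k.lt_succ_self]

theorem errRec_add (u₀ u₁ : Fin d → ℝ) (r₀ r₁ : Fin n → ℝ) (c : ℕ → Fin n → ℝ) (k : ℕ) :
    errRec X α P (u₀ + u₁) (r₀ + r₁) c k
      = errRec X α P u₀ r₀ c k + errRec X α P u₁ r₁ c k := by
  induction k with
  | zero => rfl
  | succ k ih =>
    simp only [errRec, ih, errStep]
    have e : ∀ (x y : Fin d → ℝ), c k * (X *ᵥ (x + y) - (r₀ + r₁))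
        = c k * (X *ᵥ x - r₀) + c k * (X *ᵥ y - r₁) := by
      intro x y
      rw [Matrix.mulVec_add]
      ring
    rw [e, Matrix.mulVec_add, Matrix.mulVec_add, smul_add]
    abel

/-- Random increments lie in the range of `Xᵀ`, and `Pᵀ` fixes `v`, so orthogonality to `v` survives
each step. The contraction estimate is only available on such vectors. -/
theorem errRec_dotProduct_eq_zero {u₀ : Fin d → ℝ} {r : Fin n → ℝ} {c : ℕ → Fin n → ℝ}
    {v : Fin d → ℝ} (hv : X *ᵥ v = 0) (hP : Pᵀ *ᵥ v = v) (hu : u₀ ⬝ᵥ v = 0) (k : ℕ) :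
    errRec X α P u₀ r c k ⬝ᵥ v = 0 := by
  induction k with
  | zero => exact hu
  | succ k ih =>
    rw [errRec, errStep, sub_dotProduct, mulVec_dotProduct, hP, ih, smul_dotProduct,
      mulVec_dotProduct, Matrix.transpose_transpose, hv, dotProduct_zero, smul_zero, sub_zero]

theorem measurable_errRec {E : Type*} [MeasurableSpace E] {u₀ : E → Fin d → ℝ}
    {r : E → Fin n → ℝ} (hu : Measurable u₀) (hr : Measurable r) (k : ℕ) :
    Measurable fun x : E × (ℕ → Fin n → ℝ) => errRec X α P (u₀ x.1) (r x.1) x.2 k := by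
  induction k with
  | zero => exact hu.comp measurable_fst
  | succ k ih =>
    have hstep : Measurable fun y : ((Fin n → ℝ) × (Fin n → ℝ)) × (Fin d → ℝ) =>
        errStep X α P y.1.1 y.1.2 y.2 := by
      unfold errStep
      exact Continuous.measurable (by fun_prop)
    exact hstep.comp (((hr.comp measurable_fst).prodMk
      ((measurable_pi_apply k).comp measurable_snd)).prodMk ih)

end Deterministic

/-! ### Independence of the current weighting from the past -/

section Independence

variable {Ω : Type*} [MeasurableSpace Ω] {μ : Measure Ω} [IsProbabilityMeasure μ]
  {E F : Type*} [MeasurableSpace E] [MeasurableSpace F]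

/-- A member of an independent sequence is independent of the previous members together with a
random variable that is independent of the sequence. -/
theorem indepFun_past {c : ℕ → Ω → F} {ε : Ω → E} (hc : iIndepFun c μ)
    (hcm : ∀ k, AEMeasurable (c k) μ) (hεm : AEMeasurable ε μ)
    (hε : IndepFun ε (fun ω k => c k ω) μ) (k : ℕ) :
    IndepFun (c k) (fun ω => (ε ω, fun j : Finset.range k => c j ω)) μ := by
  have hpast : AEMeasurable (fun ω (j : Finset.range k) => c j ω) μ :=
    aemeasurable_pi_lambda _ fun j => hcm j
  have h1 : IndepFun (fun ω (j : Finset.range k) => c j ω) (c k) μ := by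
    have := hc.indepFun_finset₀ (Finset.range k) {k} (by simp) hcm
    exact this.comp (φ := id) (ψ := fun x : ({k} : Finset ℕ) → F => x ⟨k, by simp⟩)
      measurable_id (measurable_pi_apply _)
  have h2 : IndepFun ε (fun ω => ((fun j : Finset.range k => c j ω), c k ω)) μ :=
    hε.comp (φ := id)
      (ψ := fun x : ℕ → F => ((fun j : Finset.range k => x j), x k)) measurable_id (by fun_prop)
  refine IndepFun.symm ?_
  have e1 := (indepFun_iff_map_prod_eq_prod_map_map hpast (hcm k)).1 h1
  have e2 := (indepFun_iff_map_prod_eq_prod_map_map hεm (hpast.prodMk (hcm k))).1 h2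
  have e3 := (indepFun_iff_map_prod_eq_prod_map_map hεm hpast).1
    (h2.comp (φ := id) measurable_id measurable_fst)
  have i1 := Measure.isProbabilityMeasure_map (μ := μ) hεm
  have i2 := Measure.isProbabilityMeasure_map (μ := μ) hpast
  have i3 := Measure.isProbabilityMeasure_map (μ := μ) (hcm k)
  -- Both sides reduce, by associativity of product measures, to the triple product of the laws of
  -- `ε`, the past and `c k`.
  rw [indepFun_iff_map_prod_eq_prod_map_map (hεm.prodMk hpast) (hcm k)]
  rw [e3, ← (MeasurePreserving.map_eq (measurePreserving_prodAssoc _ _ _).symm), ← e1, ← e2,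
    AEMeasurable.map_map_of_aemeasurable (by fun_prop) (hεm.prodMk (hpast.prodMk (hcm k)))]
  rfl

end Independence

/-! ### Second moments along the error recursion -/

section Random

variable {Ω : Type*} [MeasurableSpace Ω] {μ : Measure Ω} [IsProbabilityMeasure μ] {n d m : ℕ}
  {E : Type*} [MeasurableSpace E]
  {X : Matrix (Fin n) (Fin d) ℝ} {α : ℝ} {P : Matrix (Fin d) (Fin d) ℝ}
  {c : ℕ → Ω → Fin n → ℝ} {ε : Ω → E}
  {u₀ : E → Fin d → ℝ} {r : E → Fin n → ℝ} {η : E → Fin m → ℝ}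

theorem indepFun_errRec (hc : iIndepFun c μ) (hcL : ∀ k, SqIntegrable μ (c k))
    (hεm : AEMeasurable ε μ) (hε : IndepFun ε (fun ω k => c k ω) μ)
    (hu : Measurable u₀) (hr : Measurable r) (hη : Measurable η) (k : ℕ) :
    IndepFun (c k) (fun ω => ((errRec X α P (u₀ (ε ω)) (r (ε ω)) (fun j => c j ω) k, r (ε ω)),
      η (ε ω))) μ := by
  have h := indepFun_past hc (fun k => (hcL k).aemeasurable) hεm hε k
  -- Padding the finite past by zeros does not change the `k`-th value, which uses only weightings
  -- with index below `k`; this exhibits it as a measurable function of the noise and the past.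
  let ext : (Finset.range k → Fin n → ℝ) → ℕ → Fin n → ℝ :=
    fun x j => if hj : j ∈ Finset.range k then x ⟨j, hj⟩ else 0
  have hext : Measurable ext := by
    refine measurable_pi_lambda _ fun j => ?_
    by_cases hj : j ∈ Finset.range k
    · simpa only [ext, hj, dif_pos] using measurable_pi_apply _
    · simpa only [ext, hj, dif_neg, not_false_eq_true] using measurable_const
  have hm := measurable_errRec (X := X) (α := α) (P := P) hu hr k
  have hm' : Measurable fun x : E × (Finset.range k → Fin n → ℝ) =>
      ((errRec X α P (u₀ x.1) (r x.1) (ext x.2) k, r x.1), η x.1) :=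
    ((hm.comp (measurable_fst.prodMk (hext.comp measurable_snd))).prodMk
      (hr.comp measurable_fst)).prodMk (hη.comp measurable_fst)
  have e : ∀ ω, errRec X α P (u₀ (ε ω)) (r (ε ω)) (fun j => c j ω) k
      = errRec X α P (u₀ (ε ω)) (r (ε ω)) (ext fun j => c j ω) k := fun ω =>
    errRec_congr fun j hj => by simp [ext, hj]
  simp only [e]
  exact h.comp (φ := id) measurable_id hm'

theorem indepFun_errRec_residual (hc : iIndepFun c μ) (hcL : ∀ k, SqIntegrable μ (c k))
    (hεm : AEMeasurable ε μ) (hε : IndepFun ε (fun ω k => c k ω) μ)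
    (hu : Measurable u₀) (hr : Measurable r) (k : ℕ) :
    IndepFun (c k) (fun ω => (errRec X α P (u₀ (ε ω)) (r (ε ω)) (fun j => c j ω) k, r (ε ω))) μ :=
  (indepFun_errRec hc hcL hεm hε hu hr hr k).comp (φ := id) measurable_id measurable_fst

theorem sqIntegrable_errRec (hc : iIndepFun c μ) (hcL : ∀ k, SqIntegrable μ (c k))
    (hεm : AEMeasurable ε μ) (hε : IndepFun ε (fun ω k => c k ω) μ)
    (hu : Measurable u₀) (hr : Measurable r) (huL : SqIntegrable μ fun ω => u₀ (ε ω))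
    (hrL : SqIntegrable μ fun ω => r (ε ω)) (k : ℕ) :
    SqIntegrable μ fun ω => errRec X α P (u₀ (ε ω)) (r (ε ω)) (fun j => c j ω) k := by
  induction k with
  | zero => exact huL
  | succ k ih =>
    exact (hcL k).errStep ih hrL (indepFun_errRec_residual hc hcL hεm hε hu hr k)

/-- Starting at zero, the moment against `η` is multiplied by `P` in each step, since the centered
random term contributes nothing. It therefore stays zero. -/
theorem mom_errRec_eq_zero (hc : iIndepFun c μ) (hcL : ∀ k, SqIntegrable μ (c k))
    (hc0 : ∀ k i, ∫ ω, c k ω i ∂μ = 0)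
    (hεm : AEMeasurable ε μ) (hε : IndepFun ε (fun ω k => c k ω) μ)
    (hr : Measurable r) (hη : Measurable η)
    (hrL : SqIntegrable μ fun ω => r (ε ω)) (hηL : SqIntegrable μ fun ω => η (ε ω)) (k : ℕ) :
    mom μ (fun ω => errRec X α P 0 (r (ε ω)) (fun j => c j ω) k) (fun ω => η (ε ω)) = 0 := by
  have hu : Measurable fun _ : E => (0 : Fin d → ℝ) := measurable_const
  induction k with
  | zero =>
    ext i j
    simp [mom, errRec]
  | succ k ih =>
    exact mom_errStep_of_mom_eq_zero (hcL k) (hc0 k)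
      (sqIntegrable_errRec hc hcL hεm hε hu hr (SqIntegrable.const 0) hrL k) hrL hηL
      (indepFun_errRec_residual hc hcL hεm hε hu hr k)
      (indepFun_errRec hc hcL hεm hε hu hr hη k) ih

/-- Without residual, the second moments of the error vanish in the limit. -/
theorem tendsto_integral_sqNorm_errRec_zero {s ρ : ℝ} (hX : ‖X‖ ≤ 1)
    (hc : iIndepFun c μ) (hcL : ∀ k, SqIntegrable μ (c k)) (hc0 : ∀ k i, ∫ ω, c k ω i ∂μ = 0)
    (hs : 0 ≤ s) (hcs : ∀ k i, mom μ (c k) (c k) i i ≤ s)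
    (hεm : AEMeasurable ε μ) (hε : IndepFun ε (fun ω k => c k ω) μ)
    (hu : Measurable u₀) (huL : SqIntegrable μ fun ω => u₀ (ε ω))
    (hρ : 0 ≤ ρ) (hρs : ρ + α ^ 2 * s < 1)
    (hP : ∀ k ω, sqNorm (P *ᵥ errRec X α P (u₀ (ε ω)) 0 (fun j => c j ω) k)
      ≤ ρ * sqNorm (errRec X α P (u₀ (ε ω)) 0 (fun j => c j ω) k)) :
    Tendsto (fun k => ∫ ω, sqNorm (errRec X α P (u₀ (ε ω)) 0 (fun j => c j ω) k) ∂μ)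
      atTop (𝓝 0) := by
  have hr : Measurable fun _ : E => (0 : Fin n → ℝ) := measurable_const
  have hrL : SqIntegrable μ fun _ : Ω => (0 : Fin n → ℝ) := SqIntegrable.const 0
  set a : ℕ → ℝ := fun k => ∫ ω, sqNorm (errRec X α P (u₀ (ε ω)) 0 (fun j => c j ω) k) ∂μ
  have h0 : ∀ k, 0 ≤ a k := fun k => integral_nonneg fun ω => sqNorm_nonneg _
  have hstep : ∀ k, a (k + 1) ≤ (ρ + α ^ 2 * s) * a k := by
    intro k
    have hL := sqIntegrable_errRec (X := X) (α := α) (P := P) hc hcL hεm hε hu hr huL hrL k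
    have h1 := integral_sqNorm_errStep_le (α := α) hX (hcL k) (hc0 k) (hcs k) hL hrL
      (indepFun_errRec_residual hc hcL hεm hε hu hr k) (hP k)
    have h2 := integral_sqNorm_residual_le hX hL hrL (by ext i j; simp [mom])
    have h3 : ∫ _ : Ω, sqNorm (0 : Fin n → ℝ) ∂μ = 0 := by simp [sqNorm]
    rw [h3, add_zero] at h2
    have h4 := mul_le_mul_of_nonneg_left h2 (mul_nonneg (sq_nonneg α) hs)
    simp only [a, errRec]
    linarith
  have hpow : ∀ k, a k ≤ (ρ + α ^ 2 * s) ^ k * a 0 := by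
    intro k
    induction k with
    | zero => simp
    | succ k ih =>
      rw [pow_succ', mul_assoc]
      exact (hstep k).trans (mul_le_mul_of_nonneg_left ih (by positivity))
  refine squeeze_zero h0 hpow ?_
  simpa using (tendsto_pow_atTop_nhds_zero_of_lt_one (by positivity) hρs).mul_const (a 0)

/-- Started at zero, the second moments of the error are bounded by those of the residual. -/
theorem integral_sqNorm_errRec_le {s ρ : ℝ} (hX : ‖X‖ ≤ 1)
    (hc : iIndepFun c μ) (hcL : ∀ k, SqIntegrable μ (c k)) (hc0 : ∀ k i, ∫ ω, c k ω i ∂μ = 0)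
    (hs : 0 ≤ s) (hcs : ∀ k i, mom μ (c k) (c k) i i ≤ s)
    (hεm : AEMeasurable ε μ) (hε : IndepFun ε (fun ω k => c k ω) μ)
    (hr : Measurable r) (hrL : SqIntegrable μ fun ω => r (ε ω))
    (hρ : 0 ≤ ρ) (hρs : ρ + 2 * (α ^ 2 * s) ≤ 1)
    (hP : ∀ k ω, sqNorm (P *ᵥ errRec X α P 0 (r (ε ω)) (fun j => c j ω) k)
      ≤ ρ * sqNorm (errRec X α P 0 (r (ε ω)) (fun j => c j ω) k)) (k : ℕ) :
    ∫ ω, sqNorm (errRec X α P 0 (r (ε ω)) (fun j => c j ω) k) ∂μ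
      ≤ ∫ ω, sqNorm (r (ε ω)) ∂μ := by
  have hu : Measurable fun _ : E => (0 : Fin d → ℝ) := measurable_const
  have huL : SqIntegrable μ fun _ : Ω => (0 : Fin d → ℝ) := SqIntegrable.const 0
  have hR : 0 ≤ ∫ ω, sqNorm (r (ε ω)) ∂μ := integral_nonneg fun ω => sqNorm_nonneg _
  induction k with
  | zero => simpa [errRec, sqNorm] using hR
  | succ k ih =>
    have hL := sqIntegrable_errRec (X := X) (α := α) (P := P) hc hcL hεm hε hu hr huL hrL k
    have h1 := integral_sqNorm_errStep_le (α := α) hX (hcL k) (hc0 k) (hcs k) hL hrL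
      (indepFun_errRec_residual hc hcL hεm hε hu hr k) (hP k)
    have h2 := integral_sqNorm_residual_le hX hL hrL
      (mom_errRec_eq_zero hc hcL hc0 hεm hε hr hr hrL hrL k)
    -- The error and the residual each contribute at most `𝔼‖r‖²` to the mean square of `X e - r`;
    -- hence the factor `2` in `hρs`.
    have h4 := mul_le_mul_of_nonneg_left (h2.trans (add_le_add ih le_rfl))
      (mul_nonneg (sq_nonneg α) hs)
    have h5 := mul_le_mul_of_nonneg_left ih hρ
    have h6 := mul_le_mul_of_nonneg_right hρs hR
    simp only [errRec]
    linarith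

/-- Started at zero, the second moments of the error increase. -/
theorem monotone_integral_sqNorm_errRec {C : Matrix (Fin n) (Fin n) ℝ}
    (hc : iIndepFun c μ) (hcL : ∀ k, SqIntegrable μ (c k)) (hc0 : ∀ k i, ∫ ω, c k ω i ∂μ = 0)
    (hcC : ∀ k, mom μ (c k) (c k) = C)
    (hεm : AEMeasurable ε μ) (hε : IndepFun ε (fun ω k => c k ω) μ)
    (hr : Measurable r) (hrL : SqIntegrable μ fun ω => r (ε ω)) :
    Monotone fun k => ∫ ω, sqNorm (errRec X α P 0 (r (ε ω)) (fun j => c j ω) k) ∂μ := by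
  have hu : Measurable fun _ : E => (0 : Fin d → ℝ) := measurable_const
  have huL : SqIntegrable μ fun _ : Ω => (0 : Fin d → ℝ) := SqIntegrable.const 0
  have hL := sqIntegrable_errRec (X := X) (α := α) (P := P) hc hcL hεm hε hu hr huL hrL
  have hCp : C.PosSemidef := hcC 0 ▸ mom_self_posSemidef (hcL 0)
  set B : ℕ → Matrix (Fin d) (Fin d) ℝ := fun k =>
    mom μ (fun ω => errRec X α P 0 (r (ε ω)) (fun j => c j ω) k)
      (fun ω => errRec X α P 0 (r (ε ω)) (fun j => c j ω) k) with hB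
  -- Error and residual are uncorrelated, so the recursion closes in `B k` and is affine.
  have hstep : ∀ k, B (k + 1) = P * B k * Pᵀ + α ^ 2 • (Xᵀ * (C ⊙ (X * B k * Xᵀ
      + mom μ (fun ω => r (ε ω)) (fun ω => r (ε ω)))) * X) := by
    intro k
    have h1 := mom_errStep (X := X) (α := α) (P := P) (hcL k) (hc0 k) (hL k) hrL
      (indepFun_errRec_residual hc hcL hεm hε hu hr k)
    rw [mom_residual (hL k) hrL (mom_errRec_eq_zero hc hcL hc0 hεm hε hr hr hrL hrL k),
      hcC] at h1
    exact h1
  -- Increments evolve by the linear part alone: congruences and a Hadamard product with `C`, which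
  -- preserve positive semi-definiteness (Schur product theorem). The first increment is `B 1`, as
  -- `B 0 = 0`.
  have hdiff : ∀ k, (B (k + 1) - B k).PosSemidef := by
    intro k
    induction k with
    | zero =>
      have h0 : B 0 = 0 := by
        ext i j
        simp [hB, mom, errRec]
      rw [h0, sub_zero]
      exact mom_self_posSemidef (hL 1)
    | succ k ih =>
      have e : B (k + 2) - B (k + 1) = P * (B (k + 1) - B k) * Pᵀ
          + α ^ 2 • (Xᵀ * (C ⊙ (X * (B (k + 1) - B k) * Xᵀ)) * X) := by
        have h2 : C ⊙ (X * (B (k + 1) - B k) * Xᵀ)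
            = C ⊙ (X * B (k + 1) * Xᵀ + mom μ (fun ω => r (ε ω)) (fun ω => r (ε ω)))
              - C ⊙ (X * B k * Xᵀ + mom μ (fun ω => r (ε ω)) (fun ω => r (ε ω))) := by
          rw [Matrix.mul_sub, Matrix.sub_mul]
          ext i j
          simp only [Matrix.hadamard_apply, Matrix.sub_apply, Matrix.add_apply]
          ring
        rw [h2, Matrix.mul_sub, Matrix.sub_mul, Matrix.mul_sub, Matrix.sub_mul, smul_sub]
        refine (congrArg₂ (· - ·) (hstep (k + 1)) (hstep k)).trans ?_
        abel
      have p1 : (P * (B (k + 1) - B k) * Pᵀ).PosSemidef := by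
        simpa only [Matrix.conjTranspose_eq_transpose_of_trivial] using
          ih.mul_mul_conjTranspose_same P
      have p2 : (X * (B (k + 1) - B k) * Xᵀ).PosSemidef := by
        simpa only [Matrix.conjTranspose_eq_transpose_of_trivial] using
          ih.mul_mul_conjTranspose_same X
      have p3 : (Xᵀ * (C ⊙ (X * (B (k + 1) - B k) * Xᵀ)) * X).PosSemidef := by
        simpa only [Matrix.conjTranspose_eq_transpose_of_trivial] using
          (hCp.hadamard p2).conjTranspose_mul_mul_same X
      rw [e]
      exact p1.add (p3.smul (sq_nonneg α))
  refine monotone_nat_of_le_succ fun k => ?_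
  have := (hdiff k).trace_nonneg
  rw [Matrix.trace_sub, sub_nonneg] at this
  rw [integral_sqNorm (hL k), integral_sqNorm (hL (k + 1))]
  exact this

end Random

/-! ### From the iterates and the estimator to the error recursion -/

/-- The deviation of the iterates from a solution `w` of the weighted normal equations. -/
theorem iterate_sub_eq_errRec {n d : ℕ} (X : Matrix (Fin n) (Fin d) ℝ) (α : ℝ)
    (w₁ w : Fin d → ℝ) (y m : Fin n → ℝ) (D : ℕ → Fin n → ℝ)
    (hw : (Xᵀ * Matrix.diagonal m) *ᵥ (y - X *ᵥ w) = 0) (k : ℕ) :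
    iterate X (fun _ => α) w₁ D y k - w
      = errRec X α (1 - α • (Xᵀ * Matrix.diagonal m * X)) (w₁ - w) (y - X *ᵥ w)
          (fun j i => D j i ^ 2 - m i) k := by
  induction k with
  | zero => rfl
  | succ k ih =>
    rw [iterate, errRec, errStep, ← ih]
    set e := iterate X (fun _ => α) w₁ D y k with he
    have h1 : ∀ z : Fin n → ℝ, (fun i => D k i ^ 2 - m i) * z
        = Matrix.diagonal (D k) ^ 2 *ᵥ z - Matrix.diagonal m *ᵥ z := by
      intro z
      ext i
      simp only [Matrix.diagonal_pow, Pi.mul_apply, Pi.sub_apply, Matrix.mulVec_diagonal,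
        Pi.pow_apply]
      ring
    rw [h1]
    rw [← Matrix.mulVec_mulVec, Matrix.mulVec_sub, Matrix.mulVec_sub, sub_eq_zero] at hw
    simp only [Matrix.sub_mulVec, Matrix.one_mulVec, Matrix.smul_mulVec, Matrix.mulVec_sub,
      ← Matrix.mulVec_mulVec, smul_sub]
    rw [hw]
    abel

section

variable {Ω : Type*} [MeasurableSpace Ω] {μ : Measure Ω} {n d : ℕ}

/-- Adding a perturbation that vanishes in mean square keeps the limit of the second moments. -/
theorem tendsto_integral_sqNorm_sub {U V : ℕ → Ω → Fin d → ℝ} {L : ℝ}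
    (hU : ∀ k, SqIntegrable μ (U k)) (hV : ∀ k, SqIntegrable μ (V k))
    (hUL : Tendsto (fun k => ∫ ω, sqNorm (U k ω) ∂μ) atTop (𝓝 L))
    (hV0 : Tendsto (fun k => ∫ ω, sqNorm (V k ω) ∂μ) atTop (𝓝 0)) :
    Tendsto (fun k => ∫ ω, sqNorm (U k ω - V k ω) ∂μ) atTop (𝓝 L) := by
  have hsq : Tendsto (fun k => (∫ ω, U k ω ⬝ᵥ V k ω ∂μ) ^ 2) atTop (𝓝 0) := by
    refine squeeze_zero (fun k => sq_nonneg _)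
      (fun k => sq_integral_dotProduct_le (hU k) (hV k)) ?_
    simpa using hUL.mul hV0
  have hcross : Tendsto (fun k => ∫ ω, U k ω ⬝ᵥ V k ω ∂μ) atTop (𝓝 0) := by
    rw [tendsto_zero_iff_abs_tendsto_zero]
    have := hsq.sqrt
    simpa [Real.sqrt_sq_eq_abs, Function.comp_def] using this
  have e : ∀ k, ∫ ω, sqNorm (U k ω - V k ω) ∂μ = ∫ ω, sqNorm (U k ω) ∂μ
      - 2 * ∫ ω, U k ω ⬝ᵥ V k ω ∂μ + ∫ ω, sqNorm (V k ω) ∂μ := by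
    intro k
    have e1 : ∀ ω, sqNorm (U k ω - V k ω)
        = sqNorm (U k ω) - 2 * (U k ω ⬝ᵥ V k ω) + sqNorm (V k ω) := by
      intro ω
      simp only [sqNorm_eq_dotProduct, sub_dotProduct, dotProduct_sub,
        dotProduct_comm (V k ω) (U k ω)]
      ring
    have i1 := (hU k).integrable_sqNorm
    have i2 := ((hU k).integrable_dotProduct (hV k)).const_mul 2
    have i3 : Integrable (fun ω => sqNorm (U k ω) - 2 * (U k ω ⬝ᵥ V k ω)) μ := i1.sub i2
    simp only [e1]
    rw [integral_add i3 (hV k).integrable_sqNorm, integral_sub i1 i2, integral_const_mul]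
  simp only [e]
  simpa using (hUL.sub (hcross.const_mul 2)).add hV0

theorem mom_const_left_eq_zero {ε : Ω → Fin n → ℝ} (hε0 : ∀ i, ∫ ω, ε ω i ∂μ = 0)
    (v : Fin d → ℝ) : mom μ (fun _ => v) ε = 0 := by
  ext i j
  simp [mom, integral_const_mul, hε0]

theorem mom_self_eq_covMatrix {ε : Ω → Fin n → ℝ} (hε0 : ∀ i, ∫ ω, ε ω i ∂μ = 0) :
    mom μ ε ε = covMatrix μ ε := by
  ext i j
  simp [mom, covMatrix, covariance, hε0]

theorem integral_sqNorm_mulVec {ε : Ω → Fin n → ℝ} (hε : SqIntegrable μ ε)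
    (hε0 : ∀ i, ∫ ω, ε ω i ∂μ = 0) (A : Matrix (Fin d) (Fin n) ℝ) :
    ∫ ω, sqNorm (A *ᵥ ε ω) ∂μ = (A * covMatrix μ ε * Aᵀ).trace := by
  rw [integral_sqNorm (hε.mulVec A), mom_mulVec_left hε (hε.mulVec A), mom_mulVec_right hε hε,
    mom_self_eq_covMatrix hε0, Matrix.mul_assoc]

/-- Bias–variance decomposition. -/
theorem integral_sqNorm_const_sub_mulVec [IsProbabilityMeasure μ] {ε : Ω → Fin n → ℝ}
    (hε : SqIntegrable μ ε) (hε0 : ∀ i, ∫ ω, ε ω i ∂μ = 0) (v : Fin d → ℝ)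
    (A : Matrix (Fin d) (Fin n) ℝ) :
    ∫ ω, sqNorm (v - A *ᵥ ε ω) ∂μ = sqNorm v + (A * covMatrix μ ε * Aᵀ).trace := by
  have hv : SqIntegrable μ fun _ : Ω => v := SqIntegrable.const v
  have h0 : mom μ (fun _ : Ω => v) (fun ω => A *ᵥ ε ω) = 0 := by
    rw [mom_mulVec_right hv hε, mom_const_left_eq_zero hε0, Matrix.zero_mul]
  rw [integral_sqNorm (hv.sub (hε.mulVec A)), mom_sub_self hv (hε.mulVec A) h0, Matrix.trace_add,
    ← integral_sqNorm hv, ← integral_sqNorm (hε.mulVec A), integral_sqNorm_mulVec hε hε0]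
  simp

theorem memLp_two_sq {f : Ω → ℝ} (hf : MemLp f 4 μ) : MemLp (fun ω => f ω ^ 2) 2 μ := by
  have hm : AEStronglyMeasurable (fun ω => f ω ^ 2) μ := hf.aestronglyMeasurable.pow 2
  refine (memLp_two_iff_integrable_sq hm).2 ?_
  refine (hf.integrable_norm_pow (p := 4) (by norm_num)).congr (ae_of_all _ fun ω => ?_)
  simp only [Real.norm_eq_abs]
  rw [Even.pow_abs (by decide), ← pow_mul]

/-- The centered squares of independent copies of `D`. -/
theorem mom_centered_sq_of_identDistrib {D D' : Ω → Fin n → ℝ} (h : IdentDistrib D' D μ μ) :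
    mom μ (fun ω i => D' ω i ^ 2 - ∫ ω', D ω' i ^ 2 ∂μ) (fun ω i => D' ω i ^ 2 - ∫ ω', D ω' i ^ 2 ∂μ)
      = SigmaD μ D := by
  ext i j
  have := (h.comp (u := fun x : Fin n → ℝ => (x i ^ 2 - ∫ ω', D ω' i ^ 2 ∂μ)
    * (x j ^ 2 - ∫ ω', D ω' j ^ 2 ∂μ)) (by fun_prop)).integral_eq
  exact this

theorem sqIntegrable_centered_sq_of_identDistrib [IsProbabilityMeasure μ]
    {D D' : Ω → Fin n → ℝ} (h : IdentDistrib D' D μ μ)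
    (hD : ∀ i, MemLp (fun ω => D ω i) 4 μ) :
    SqIntegrable μ fun ω i => D' ω i ^ 2 - ∫ ω', D ω' i ^ 2 ∂μ := by
  intro i
  have h1 : MemLp (fun ω => D' ω i ^ 2) 2 μ :=
    (h.comp (u := fun x : Fin n → ℝ => x i ^ 2) (by fun_prop)).memLp_iff.2 (memLp_two_sq (hD i))
  exact h1.sub (memLp_const _)

theorem integral_centered_sq_of_identDistrib [IsProbabilityMeasure μ]
    {D D' : Ω → Fin n → ℝ} (h : IdentDistrib D' D μ μ)
    (hD : ∀ i, MemLp (fun ω => D ω i) 4 μ) (i : Fin n) :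
    ∫ ω, (D' ω i ^ 2 - ∫ ω', D ω' i ^ 2 ∂μ) ∂μ = 0 := by
  have h1 := h.comp (u := fun x : Fin n → ℝ => x i ^ 2) (by fun_prop)
  have h2 : MemLp (fun ω => D' ω i ^ 2) 2 μ := h1.memLp_iff.2 (memLp_two_sq (hD i))
  have h3 : ∫ ω, D' ω i ^ 2 ∂μ = ∫ ω, D ω i ^ 2 ∂μ := h1.integral_eq
  rw [integral_sub (h2.integrable one_le_two) (integrable_const _), h3]
  simp

theorem sqrtM2_transpose (D : Ω → Fin n → ℝ) : (sqrtM2 μ D)ᵀ = sqrtM2 μ D :=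
  Matrix.diagonal_transpose _

theorem isUnit_sqrtM2 {D : Ω → Fin n → ℝ} (h : IsUnit (M2 μ D)) : IsUnit (sqrtM2 μ D) := by
  rw [← sqrtM2_mul_self, Matrix.isUnit_iff_isUnit_det, Matrix.det_mul] at h
  exact (Matrix.isUnit_iff_isUnit_det _).2 (isUnit_of_mul_isUnit_left h)

theorem XXhat_posSemidef (D : Ω → Fin n → ℝ) (X : Matrix (Fin n) (Fin d) ℝ) :
    (XXhat μ D X).PosSemidef := by
  have h := Matrix.posSemidef_conjTranspose_mul_self (sqrtM2 μ D * X)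
  rwa [Matrix.conjTranspose_eq_transpose_of_trivial, Matrix.transpose_mul, sqrtM2_transpose,
    Matrix.mul_assoc, ← Matrix.mul_assoc (sqrtM2 μ D), sqrtM2_mul_self, ← Matrix.mul_assoc] at h

end

/-- The deviation of the least squares estimator splits into bias and noise. -/
theorem sub_wHat_eq {Ω : Type*} [MeasurableSpace Ω] {μ : Measure Ω} {n d : ℕ} {D : Ω → Fin n → ℝ}
    (hM2 : IsUnit (M2 μ D)) (X : Matrix (Fin n) (Fin d) ℝ) (w : Fin d → ℝ) (e : Fin n → ℝ) :
    w - wHat μ D X (X *ᵥ w + e)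
      = (1 - pinv X * X) *ᵥ w - (pinv (Xhat μ D X) * sqrtM2 μ D) *ᵥ e := by
  have h := pinv_mul_self_weighted X (isUnit_sqrtM2 hM2)
  rw [wHat, Matrix.mulVec_mulVec, Matrix.mulVec_add, Matrix.mulVec_mulVec, Matrix.mul_assoc, Xhat, h,
    Matrix.sub_mulVec, Matrix.one_mulVec]
  abel

/-- The residual of the least squares estimator depends on the noise alone. -/
theorem sub_mulVec_wHat_eq {Ω : Type*} [MeasurableSpace Ω] {μ : Measure Ω} {n d : ℕ}
    {D : Ω → Fin n → ℝ} (hM2 : IsUnit (M2 μ D)) (X : Matrix (Fin n) (Fin d) ℝ) (w : Fin d → ℝ)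
    (e : Fin n → ℝ) :
    X *ᵥ w + e - X *ᵥ wHat μ D X (X *ᵥ w + e)
      = (1 - X * pinv (Xhat μ D X) * sqrtM2 μ D) *ᵥ e := by
  have h := mul_pinv_mul_weighted X (isUnit_sqrtM2 hM2)
  have h2 : X *ᵥ wHat μ D X (X *ᵥ w) = X *ᵥ w := by
    rw [wHat, Matrix.mulVec_mulVec, Matrix.mulVec_mulVec, Matrix.mulVec_mulVec, Xhat]
    simp only [Matrix.mul_assoc] at h ⊢
    rw [h]
  have h3 : wHat μ D X (X *ᵥ w + e) = wHat μ D X (X *ᵥ w) + wHat μ D X e := by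
    simp only [wHat, Matrix.mulVec_add]
  have h4 : X *ᵥ wHat μ D X e = (X * pinv (Xhat μ D X) * sqrtM2 μ D) *ᵥ e := by
    simp only [wHat, Matrix.mulVec_mulVec, Matrix.mul_assoc]
  rw [h3, Matrix.mulVec_add, h2, h4, Matrix.sub_mulVec, Matrix.one_mulVec]
  abel

end WeightedGD

/-! ### The limiting risk -/

open WeightedGD

theorem mainTheorem4 {Ω : Type*} [MeasurableSpace Ω] (μ : Measure Ω) [IsProbabilityMeasure μ]
    {n d : ℕ}
    -- the design matrix, the true parameter, the noise and the labels
    (X : Matrix (Fin n) (Fin d) ℝ) (wStar : Fin d → ℝ)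
    (ε : Ω → Fin n → ℝ) (Y : Ω → Fin n → ℝ)
    (hY : ∀ ω, Y ω = X *ᵥ wStar + ε ω)
    (hε_meas : AEMeasurable ε μ)
    (hε_L2 : ∀ i, MemLp (fun ω => ε ω i) 2 μ)
    (hε_centered : ∀ i, ∫ ω, ε ω i ∂μ = 0)
    -- the generic random weighting `D` and its independent copies `Ds 0, Ds 1, …`
    (D : Ω → Fin n → ℝ) (Ds : ℕ → Ω → Fin n → ℝ)
    (hDs_copy : ∀ k, IdentDistrib (Ds k) D μ μ)
    (hDs_indep : iIndepFun Ds μ)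
    (hε_indep : IndepFun ε (fun ω k => Ds k ω) μ)
    (hD_L4 : ∀ i, MemLp (fun ω => D ω i) 4 μ)
    (hM2 : IsUnit (WeightedGD.M2 μ D))
    -- normalization, step size and deterministic initialization
    (hX : ‖X‖ = 1)
    (α : ℝ) (hα_pos : 0 < α)
    (hα_norm : α * ‖WeightedGD.XXhat μ D X‖ < 1)
    (hα_lt : α < WeightedGD.sigmaMinPos (WeightedGD.XXhat μ D X) /
      (WeightedGD.sigmaMinPos (WeightedGD.XXhat μ D X) ^ 2
        + ‖X‖ ^ 4 * ‖WeightedGD.SigmaD μ D‖))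
    (w₁ : Fin d → ℝ) (hw₁ : ∀ v : Fin d → ℝ, X *ᵥ v = 0 → w₁ ⬝ᵥ v = 0) :
    -- the risk `C` of the weighted least squares estimator
    Integrable (fun ω => WeightedGD.sqNorm (wStar - WeightedGD.wHat μ D X (Y ω))) μ ∧
    (∫ ω, WeightedGD.sqNorm (wStar - WeightedGD.wHat μ D X (Y ω)) ∂μ
      = WeightedGD.sqNorm ((1 - WeightedGD.pinv X * X) *ᵥ wStar)
        + Matrix.trace
            ((WeightedGD.pinv (WeightedGD.Xhat μ D X) * WeightedGD.sqrtM2 μ D)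
              * WeightedGD.covMatrix μ ε
              * (WeightedGD.pinv (WeightedGD.Xhat μ D X) * WeightedGD.sqrtM2 μ D)ᵀ)) ∧
    -- the limiting risk of the iterates exists and lies between the two bounds
    (∀ k, Integrable (fun ω => WeightedGD.sqNorm
      (wStar - WeightedGD.iterate X (fun _ => α) w₁ (fun j => Ds j ω) (Y ω) k)) μ) ∧
    ∃ L : ℝ,
      Tendsto (fun k => ∫ ω, WeightedGD.sqNorm
        (wStar - WeightedGD.iterate X (fun _ => α) w₁ (fun j => Ds j ω) (Y ω) k) ∂μ)
        atTop (𝓝 L) ∧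
      ∫ ω, WeightedGD.sqNorm (wStar - WeightedGD.wHat μ D X (Y ω)) ∂μ ≤ L ∧
      L ≤ ∫ ω, WeightedGD.sqNorm (wStar - WeightedGD.wHat μ D X (Y ω)) ∂μ
        + Matrix.trace
            ((1 - X * WeightedGD.pinv (WeightedGD.Xhat μ D X) * WeightedGD.sqrtM2 μ D)
              * WeightedGD.covMatrix μ ε
              * (1 - X * WeightedGD.pinv (WeightedGD.Xhat μ D X) * WeightedGD.sqrtM2 μ D)ᵀ) := by
  have hε : SqIntegrable μ ε := hε_L2
  set B := pinv (Xhat μ D X) * sqrtM2 μ D with hB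
  set K := 1 - X * pinv (Xhat μ D X) * sqrtM2 μ D with hK
  set G : (Fin n → ℝ) → Fin d → ℝ := fun e => wStar - wHat μ D X (X *ᵥ wStar + e) with hG
  have hG_eq : ∀ e, G e = (1 - pinv X * X) *ᵥ wStar - B *ᵥ e := fun e => sub_wHat_eq hM2 X wStar e
  have hG_meas : Measurable G := by
    simp only [hG, wHat]
    exact Continuous.measurable (by fun_prop)
  have hG_L2 : SqIntegrable μ fun ω => G (ε ω) := by
    simp only [hG_eq]
    exact (SqIntegrable.const _).sub (hε.mulVec B)
  have hGY : ∀ ω, wStar - wHat μ D X (Y ω) = G (ε ω) := fun ω => by rw [hY]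
  -- the centered weightings
  set c : ℕ → Ω → Fin n → ℝ := fun k ω i => Ds k ω i ^ 2 - ∫ ω', D ω' i ^ 2 ∂μ with hc
  have hc_indep : iIndepFun c μ := hDs_indep.comp
    (fun _ (x : Fin n → ℝ) i => x i ^ 2 - ∫ ω', D ω' i ^ 2 ∂μ) (fun _ => by fun_prop)
  have hc_L2 : ∀ k, SqIntegrable μ (c k) := fun k =>
    sqIntegrable_centered_sq_of_identDistrib (hDs_copy k) hD_L4
  have hc_zero : ∀ k i, ∫ ω, c k ω i ∂μ = 0 := fun k =>
    integral_centered_sq_of_identDistrib (hDs_copy k) hD_L4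
  have hc_mom : ∀ k, mom μ (c k) (c k) = SigmaD μ D := fun k =>
    mom_centered_sq_of_identDistrib (hDs_copy k)
  have hc_le : ∀ k i, mom μ (c k) (c k) i i ≤ ‖SigmaD μ D‖ := fun k i => by
    rw [hc_mom]
    exact diag_le_norm _ i
  have hεc : IndepFun ε (fun ω k => c k ω) μ := hε_indep.comp (φ := id)
    (ψ := fun (x : ℕ → Fin n → ℝ) k i => x k i ^ 2 - ∫ ω', D ω' i ^ 2 ∂μ) measurable_id
    (by fun_prop)
  -- the error recursion
  set P := 1 - α • XXhat μ D X with hP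
  have hP_ker : ∀ v, X *ᵥ v = 0 → Pᵀ *ᵥ v = v := by
    intro v hv
    have ht : Pᵀ = P := by
      have := (XXhat_posSemidef (μ := μ) D X).isHermitian
      rw [Matrix.IsHermitian, Matrix.conjTranspose_eq_transpose_of_trivial] at this
      rw [hP, Matrix.transpose_sub, Matrix.transpose_smul, this, Matrix.transpose_one]
    rw [ht, hP, Matrix.sub_mulVec, Matrix.smul_mulVec, XXhat, ← Matrix.mulVec_mulVec, hv]
    simp
  set u₀ : (Fin n → ℝ) → Fin d → ℝ := fun e => w₁ - wHat μ D X (X *ᵥ wStar + e) with hu₀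
  have hu₀_eq : ∀ e, u₀ e = (w₁ - wStar) + G e := fun e => by simp [hu₀, hG]
  have hu₀_meas : Measurable u₀ := by
    simp only [hu₀, wHat]
    exact Continuous.measurable (by fun_prop)
  have hu₀_L2 : SqIntegrable μ fun ω => u₀ (ε ω) := by
    simp only [hu₀_eq]
    exact (SqIntegrable.const _).add hG_L2
  have hK_meas : Measurable fun e : Fin n → ℝ => K *ᵥ e := Continuous.measurable (by fun_prop)
  have hK_L2 : SqIntegrable μ fun ω => K *ᵥ ε ω := hε.mulVec K
  have hu₀_ker : ∀ e v, X *ᵥ v = 0 → u₀ e ⬝ᵥ v = 0 := by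
    intro e v hv
    have h1 : Xhat μ D X *ᵥ v = 0 := by
      rw [Xhat, ← Matrix.mulVec_mulVec, hv, Matrix.mulVec_zero]
    rw [hu₀, sub_dotProduct, hw₁ v hv, wHat, pinv_mulVec_dotProduct _ _ h1, sub_zero]
  have hXX_ker : ∀ v, XXhat μ D X *ᵥ v = 0 → X *ᵥ v = 0 := by
    intro v hv
    rw [XXhat, ← sqrtM2_mul_self] at hv
    exact mulVec_eq_zero_of_transpose_mul_mul X (sqrtM2_transpose D) (isUnit_sqrtM2 hM2) hv
  have hcontr : ∀ u : Fin d → ℝ, (∀ v, X *ᵥ v = 0 → u ⬝ᵥ v = 0) →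
      sqNorm (P *ᵥ u) ≤ (1 - α * sigmaMinPos (XXhat μ D X)) ^ 2 * sqNorm u := fun u hu =>
    sqNorm_one_sub_smul_mulVec_le (XXhat_posSemidef D X) hα_pos hα_norm
      fun v hv => hu v (hXX_ker v hv)
  -- Three contributions: the estimator's own error, the fluctuation fed by the residual, and the
  -- transient from the initial guess.
  have hsplit : ∀ ω k, wStar - iterate X (fun _ => α) w₁ (fun j => Ds j ω) (Y ω) k
      = (G (ε ω) - errRec X α P 0 (K *ᵥ ε ω) (fun j => c j ω) k)
        - errRec X α P (u₀ (ε ω)) 0 (fun j => c j ω) k := by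
    intro ω k
    have hres := sub_mulVec_wHat_eq hM2 X wStar (ε ω)
    have hnormal : (Xᵀ * Matrix.diagonal fun i => ∫ ω', D ω' i ^ 2 ∂μ) *ᵥ
        (Y ω - X *ᵥ wHat μ D X (Y ω)) = 0 := by
      have h := transpose_mul_mul_residual X (sqrtM2 μ D) (sqrtM2_transpose D)
      rw [sqrtM2_mul_self] at h
      rw [hY, hres, Matrix.mulVec_mulVec]
      exact (congrArg (· *ᵥ ε ω) h).trans (Matrix.zero_mulVec _)
    have h1 := iterate_sub_eq_errRec X α w₁ _ _ _ (fun j => Ds j ω) hnormal k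
    have h2 := errRec_add (X := X) (α := α) (P := P) (u₀ (ε ω)) 0 0 (K *ᵥ ε ω) (fun j => c j ω) k
    rw [add_zero, zero_add] at h2
    have h3 : iterate X (fun _ => α) w₁ (fun j => Ds j ω) (Y ω) k - wHat μ D X (Y ω)
        = errRec X α P (u₀ (ε ω)) (K *ᵥ ε ω) (fun j => c j ω) k := by
      rw [h1, hY, hres]
      rfl
    rw [h2] at h3
    rw [← hGY, ← sub_add_sub_cancel wStar (wHat μ D X (Y ω)), ← neg_sub (iterate X _ _ _ _ k), h3]
    abel
  have ha_L2 := sqIntegrable_errRec (X := X) (α := α) (P := P) hc_indep hc_L2 hε_meas hεc hu₀_meas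
    measurable_const hu₀_L2 (SqIntegrable.const 0)
  have hb_L2 := sqIntegrable_errRec (X := X) (α := α) (P := P) hc_indep hc_L2 hε_meas hεc
    measurable_const hK_meas (SqIntegrable.const 0) hK_L2
  -- the step size condition
  set σ := sigmaMinPos (XXhat μ D X) with hσ
  set s := ‖SigmaD μ D‖ with hs
  have hs0 : 0 ≤ s := norm_nonneg _
  -- If `σ` were zero, the step size bound would be zero, contradicting `0 < α`.
  have hσ0 : 0 < σ := by
    refine (sigmaMinPos_nonneg _).lt_of_ne fun h => ?_
    rw [← hσ] at h
    rw [← h, zero_div] at hα_lt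
    exact hα_pos.not_gt hα_lt
  have hstep : α ^ 2 * σ ^ 2 + α ^ 2 * s < α * σ := by
    rw [hX, one_pow, one_mul, lt_div_iff₀ (by positivity)] at hα_lt
    have := mul_lt_mul_of_pos_left hα_lt hα_pos
    linarith
  -- Expanding the square, `hstep` bounds the left side by `1 - ασ`.
  have hq1 : (1 - α * σ) ^ 2 + α ^ 2 * s < 1 := by
    have := mul_pos hα_pos hσ0
    linarith
  -- Using `hstep` twice bounds the left side by `1 - α²σ²`.
  have hq2 : (1 - α * σ) ^ 2 + 2 * (α ^ 2 * s) ≤ 1 := by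
    have := mul_nonneg (sq_nonneg α) (sq_nonneg σ)
    linarith
  have ha_lim := tendsto_integral_sqNorm_errRec_zero hX.le hc_indep hc_L2 hc_zero hs0 hc_le hε_meas
    hεc hu₀_meas hu₀_L2 (sq_nonneg _) hq1 fun k ω => hcontr _ fun v hv =>
      errRec_dotProduct_eq_zero hv (hP_ker v hv) (hu₀_ker _ v hv) k
  have hb_le := integral_sqNorm_errRec_le hX.le hc_indep hc_L2 hc_zero hs0 hc_le hε_meas
    hεc hK_meas hK_L2 (sq_nonneg _) hq2 fun k ω => hcontr _ fun v hv =>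
      errRec_dotProduct_eq_zero hv (hP_ker v hv) (zero_dotProduct v) k
  have hb_mono := monotone_integral_sqNorm_errRec (X := X) (α := α) (P := P) hc_indep hc_L2 hc_zero
    hc_mom hε_meas hεc hK_meas hK_L2
  have hb_mom := mom_errRec_eq_zero (X := X) (α := α) (P := P) hc_indep hc_L2 hc_zero hε_meas hεc
    hK_meas hG_meas hK_L2 hG_L2
  have hb_lim := tendsto_atTop_ciSup hb_mono ⟨_, Set.forall_mem_range.2 hb_le⟩
  set Lb := ⨆ k, ∫ ω, sqNorm (errRec X α P 0 (K *ᵥ ε ω) (fun j => c j ω) k) ∂μ with hLb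
  have hLb_nonneg : 0 ≤ Lb :=
    ge_of_tendsto' hb_lim fun k => integral_nonneg fun ω => sqNorm_nonneg _
  have hLb_le : Lb ≤ (K * covMatrix μ ε * Kᵀ).trace := by
    rw [← integral_sqNorm_mulVec hε hε_centered K]
    exact le_of_tendsto' hb_lim hb_le
  have hGb_lim : Tendsto (fun k => ∫ ω, sqNorm (G (ε ω)
      - errRec X α P 0 (K *ᵥ ε ω) (fun j => c j ω) k) ∂μ) atTop
      (𝓝 (∫ ω, sqNorm (G (ε ω)) ∂μ + Lb)) := by
    have e : ∀ k, ∫ ω, sqNorm (G (ε ω) - errRec X α P 0 (K *ᵥ ε ω) (fun j => c j ω) k) ∂μ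
        = ∫ ω, sqNorm (G (ε ω)) ∂μ
          + ∫ ω, sqNorm (errRec X α P 0 (K *ᵥ ε ω) (fun j => c j ω) k) ∂μ := by
      -- Pythagoras: the fluctuation is uncorrelated with `G (ε ω)`, a function of the noise alone.
      intro k
      rw [integral_sqNorm (hG_L2.sub (hb_L2 k)), mom_sub_self hG_L2 (hb_L2 k)
        (by rw [← mom_transpose, hb_mom k, Matrix.transpose_zero]), Matrix.trace_add,
        ← integral_sqNorm hG_L2, ← integral_sqNorm (hb_L2 k)]
    simp only [e]
    exact hb_lim.const_add _
  simp only [hGY, hsplit]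
  refine ⟨hG_L2.integrable_sqNorm, ?_,
    fun k => ((hG_L2.sub (hb_L2 k)).sub (ha_L2 k)).integrable_sqNorm,
    ∫ ω, sqNorm (G (ε ω)) ∂μ + Lb,
    tendsto_integral_sqNorm_sub (fun k => hG_L2.sub (hb_L2 k)) ha_L2 hGb_lim ha_lim,
    le_add_of_nonneg_right hLb_nonneg, add_le_add le_rfl hLb_le⟩
  simp only [hG_eq]
  exact integral_sqNorm_const_sub_mulVec hε hε_centered _ B
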